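/- Let $n,r,d\ge 0$ be integers and let $U=\{u_1\prec\dots\prec u_n\}$ and $V=\{v_1\prec\dots\prec v_n\}$ be disjoint totally ordered sets. Call a bipartite multigraph with color classes $U,V$ $r$-regular if every vertex lies on exactly $r$ edges, counted with multiplicity. Two edges $uv$ and $u'v'$ cross if $u\prec u'$ and $v'\prec v$, or $u'\prec u$ and $v\prec v'$; thus edges that share an endpoint (in particular parallel edges) do not cross. Let $\hat g(n;d)$ be the number of $r$-regular bipartite multigraphs with color classes $U,V$ in which every set of pairwise non-crossing edges (which may share endpoints; parallel edges are counted separately) has at most $d$ elements. Let $T([rn];d)$ be the set of standard Young tableaux in which each element of $[rn]=\{1,\dots,rn\}$ appears exactly once and which have at most $d$ columns. Say that such a tableau satisfies Condition $(\hat T)$ if for all $i\in[n]$ and $1\le s<r$ the row containing $r(i-1)+s+1$ is weakly above the row containing $r(i-1)+s$ (rows are numbered from top to bottom). For a permutation $\pi$ of $[d]$ let $T(\pi)=(1-\pi(1),\dots,d-\pi(d))\in\mathbb Z^d$. Let $\widehat W'(d,2rn;T(\pi))$ be the set of lattice walks of length $2rn$ in $\mathbb Z^d$ (each step is $\pm e_j$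 for some $j\in[d]$) from the origin to $T(\pi)$ in which all positive steps precede all negative steps, and such that, if the positive steps are in order $e_{a_1},\dots,e_{a_{rn}}$ and the negative steps are in order $-e_{b_1},\dots,-e_{b_{rn}}$, then $a_{r(i-1)+s}<a_{r(i-1)+s+1}$ and $b_{r(i-1)+s}<b_{r(i-1)+s+1}$ for all $i\in[n]$ and $1\le s<r$. (Since the coordinates of $T(\pi)$ sum to $0$, there are exactly $rn$ steps of either sign.) Then $\hat g(n;d)$ equals the number of ordered pairs of tableaux of equal shape in $T([rn];d)$ both of which satisfy Condition $(\hat T)$. Moreover, $$\hat g(n;d)=\sum_{\pi}\operatorname{sgn}(\pi)\,\bigl|\widehat W'(d,2rn;T(\pi))\bigr|,$$ where the sum is over all permutations $\pi$ of $[d]$. -/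

import Mathlib

namespace PlanarSubgraph

/-! ### Bipartite multigraphs with linearly ordered color classes

A bipartite multigraph with color classes `U` and `V` is the multiset `E` of its edges, an edge
between `u : U` and `v : V` being the pair `(u, v)`. -/

/-- `E` is `r`-regular: every vertex of either color class lies on exactly `r` edges, counted
with multiplicity. -/
def IsRegular {U V : Type*} [LinearOrder U] [LinearOrder V] (r : ℕ) (E : Multiset (U × V)) :
    Prop :=
  (∀ u : U, (E.map Prod.fst).count u = r) ∧ (∀ v : V, (E.map Prod.snd).count v = r)

/-- Two edges cross if their endpoints are in strictly opposite orders in the two color classes.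
Edges that share one or both endpoints do not cross. -/
def Cross {U V : Type*} [LinearOrder U] [LinearOrder V] (e f : U × V) : Prop :=
  (e.1 < f.1 ∧ f.2 < e.2) ∨ (f.1 < e.1 ∧ e.2 < f.2)

/-- A collection of edges (with repetitions allowed, for parallel edges) no two of which cross. -/
def IsPlanar {U V : Type*} [LinearOrder U] [LinearOrder V] (S : Multiset (U × V)) : Prop :=
  ∀ e ∈ S, ∀ f ∈ S, ¬ Cross e f

/-- The `r`-regular bipartite multigraphs with color classes `U` and `V` all of whose sets of
pairwise non-crossing edges, which may share endpoints, have at most `d` edges. -/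
def multigraphs (U V : Type*) [LinearOrder U] [LinearOrder V] (r d : ℕ) :
    Set (Multiset (U × V)) :=
  {E | IsRegular r E ∧ ∀ S ≤ E, IsPlanar S → Multiset.card S ≤ d}

/-! ### Blocks

The linearly ordered set `[n] × [r]` (lexicographic order) is identified with `[rn]`, everything
being indexed from `0`. -/

/-- The `s`-th element of the `i`-th block, that is `r * i + s`. -/
def blockIndex {n r : ℕ} (i : Fin n) (s : Fin r) : Fin (n * r) := finProdFinEquiv (i, s)

/-! ### Standard Young tableaux -/

/-- A standard Young tableau of shape `μ` with set of entries `Fin m`. A cell `(k, l)` is in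
row `k` (counted from the top) and column `l` (counted from the left). -/
structure StandardTableau (μ : YoungDiagram) (m : ℕ) where
  /-- the entry in each cell; every element of `Fin m` occurs exactly once -/
  entry : {c : ℕ × ℕ // c ∈ μ} ≃ Fin m
  /-- entries increase along each row, from left to right -/
  row_lt : ∀ c c' : {c : ℕ × ℕ // c ∈ μ},
    c.1.1 = c'.1.1 → c.1.2 < c'.1.2 → entry c < entry c'
  /-- entries increase along each column, from top to bottom -/
  col_lt : ∀ c c' : {c : ℕ × ℕ // c ∈ μ},
    c.1.2 = c'.1.2 → c.1.1 < c'.1.1 → entry c < entry c'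

/-- The index of the row that contains the entry `x`. -/
def StandardTableau.row {μ : YoungDiagram} {m : ℕ} (T : StandardTableau μ m) (x : Fin m) : ℕ :=
  (T.entry.symm x).1.1

/-- Within each block, the row of each entry is weakly above the row of the previous entry. -/
def StandardTableau.BlockCondition {μ : YoungDiagram} {n r : ℕ}
    (T : StandardTableau μ (n * r)) : Prop :=
  ∀ (i : Fin n) (s t : Fin r), (t : ℕ) = s + 1 →
    T.row (blockIndex i t) ≤ T.row (blockIndex i s)

/-- The pairs of standard Young tableaux of the same shape with set of entries `[rn]` and at most
`d` columns, both of which satisfy the block condition. -/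
def tableauPairs (n r d : ℕ) :
    Set (Σ μ : YoungDiagram, StandardTableau μ (n * r) × StandardTableau μ (n * r)) :=
  {x | x.1.rowLen 0 ≤ d ∧ x.2.1.BlockCondition ∧ x.2.2.BlockCondition}

/-! ### Lattice walks -/

/-- The lattice walks `w_0 ... w_L` of length `L` in `ℤ^d` from the origin to `p`: consecutive
points are at `ℓ¹`-distance `1`. -/
def walks (d L : ℕ) (p : Fin d → ℤ) : Set (Fin (L + 1) → Fin d → ℤ) :=
  {w | w 0 = 0 ∧ w (Fin.last L) = p ∧
    ∀ k : Fin L, ∑ j, |w k.succ j - w k.castSucc j| = 1}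

/-- The `k`-th step of `w` is a positive step in direction `j`. -/
def IsPosStep {d L : ℕ} (w : Fin (L + 1) → Fin d → ℤ) (k : Fin L) (j : Fin d) : Prop :=
  w k.succ - w k.castSucc = Pi.single j 1

/-- The `k`-th step of `w` is a negative step in direction `j`. -/
def IsNegStep {d L : ℕ} (w : Fin (L + 1) → Fin d → ℤ) (k : Fin L) (j : Fin d) : Prop :=
  w k.succ - w k.castSucc = -Pi.single j 1

/-- The walks in a collection `W` all of whose positive steps precede all negative steps. -/
def representatives {d L : ℕ} (W : Set (Fin (L + 1) → Fin d → ℤ)) :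
    Set (Fin (L + 1) → Fin d → ℤ) :=
  {w ∈ W | ∀ (k l : Fin L) (i j : Fin d), IsPosStep w k i → IsNegStep w l j → k < l}

/-- The sequence of labels `a` is strictly increasing within each block. -/
def StrictInBlocks {n r d : ℕ} (a : Fin (n * r) → Fin d) : Prop :=
  ∀ (i : Fin n) (s t : Fin r), (t : ℕ) = s + 1 → a (blockIndex i s) < a (blockIndex i t)

/-- The walks of length `2rn` from the origin to `p` whose positive steps precede the negative
steps, with directions `a` of the `rn` positive steps and directions `b` of the `rn` negative
steps, both strictly increasing within each block. -/
def blockWalks (n r d : ℕ) (p : Fin d → ℤ) : Set (Fin (n * r + n * r + 1) → Fin d → ℤ) :=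
  {w ∈ representatives (walks d (n * r + n * r) p) |
    ∃ a b : Fin (n * r) → Fin d,
      (∀ k, IsPosStep w (Fin.castAdd (n * r) k) (a k)) ∧
      (∀ k, IsNegStep w (Fin.natAdd (n * r) k) (b k)) ∧
      StrictInBlocks a ∧ StrictInBlocks b}

/-- The Toeplitz point `(1 - π(1), ..., d - π(d))`. -/
def toeplitzPoint {d : ℕ} (π : Equiv.Perm (Fin d)) : Fin d → ℤ :=
  fun i => (i : ℤ) - (π i : ℤ)

/-! ### The three counted sets are finite -/

theorem multigraphs_finite (U V : Type*) [Fintype U] [Fintype V] [LinearOrder U] [LinearOrder V]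
    (r d : ℕ) : (multigraphs U V r d).Finite := by
  refine (Multiset.powerset
    (∑ e : U × V, Multiset.replicate r e)).toFinset.finite_toSet.subset fun E hE => ?_
  simp only [Finset.mem_coe, Multiset.mem_toFinset, Multiset.mem_powerset]
  rw [Multiset.le_iff_count]
  intro e
  have h1 : E.count e ≤ (E.map Prod.fst).count e.1 := by
    rw [Multiset.count_map, ← Multiset.count_filter_of_pos (p := fun a => e.1 = a.1) rfl]
    exact Multiset.count_le_card _ _
  rw [hE.1.1 e.1] at h1
  refine h1.trans ?_
  rw [Multiset.count_sum']
  refine le_trans ?_ (Finset.single_le_sum (fun _ _ => Nat.zero_le _) (Finset.mem_univ e))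
  simp

theorem StandardTableau.ext_entry {μ : YoungDiagram} {m : ℕ} {T T' : StandardTableau μ m}
    (h : T.entry = T'.entry) : T = T' := by
  cases T; cases T'; cases h; rfl

theorem tableauPairs_finite (n r d : ℕ) : (tableauPairs n r d).Finite := by
  have hfin : ∀ μ : YoungDiagram, ∀ m, Finite (StandardTableau μ m) := by
    intro μ m
    have : Finite {c : ℕ × ℕ // c ∈ μ} := μ.cells.finite_toSet
    exact Finite.of_injective StandardTableau.entry fun _ _ h => StandardTableau.ext_entry h
  have hshape : {μ : YoungDiagram | μ.cells.card = n * r}.Finite := by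
    refine Set.Finite.of_finite_image (f := YoungDiagram.cells) ?_ ?_
    · refine ((Finset.range (n * r) ×ˢ Finset.range (n * r)).powerset.finite_toSet).subset ?_
      rintro _ ⟨μ, hμ, rfl⟩
      simp only [Finset.mem_coe, Finset.mem_powerset]
      rintro ⟨i, j⟩ hc
      rw [Set.mem_ofPred_eq] at hμ
      have h1 : (Finset.range (i + 1)).card ≤ μ.cells.card :=
        Finset.card_le_card_of_injOn (fun k => (k, j))
          (fun k hk => μ.isLowerSet (by
            simp only [Finset.coe_range, Set.mem_Iio] at hk
            exact Prod.mk_le_mk.2 ⟨by omega, le_rfl⟩) hc)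
          (fun a _ b _ h => (Prod.mk.inj h).1)
      have h2 : (Finset.range (j + 1)).card ≤ μ.cells.card :=
        Finset.card_le_card_of_injOn (fun k => (i, k))
          (fun k hk => μ.isLowerSet (by
            simp only [Finset.coe_range, Set.mem_Iio] at hk
            exact Prod.mk_le_mk.2 ⟨le_rfl, by omega⟩) hc)
          (fun a _ b _ h => (Prod.mk.inj h).2)
      simp only [Finset.card_range] at h1 h2
      simp only [Finset.mem_product, Finset.mem_range]
      omega
    · intro a _ b _ h
      exact YoungDiagram.ext h
  have hS : Finite {μ : YoungDiagram | μ.cells.card = n * r} := hshape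
  have hF : Finite (Σ μ : {μ : YoungDiagram | μ.cells.card = n * r},
      StandardTableau μ.1 (n * r) × StandardTableau μ.1 (n * r)) := by
    have := fun μ => hfin μ (n * r)
    infer_instance
  refine (Set.finite_range fun x : (Σ μ : {μ : YoungDiagram | μ.cells.card = n * r},
      StandardTableau μ.1 (n * r) × StandardTableau μ.1 (n * r)) =>
    (⟨x.1.1, x.2⟩ : Σ μ : YoungDiagram,
      StandardTableau μ (n * r) × StandardTableau μ (n * r))).subset ?_
  rintro ⟨μ, T, T'⟩ -
  have h : μ.cells.card = n * r := by
    have h := Nat.card_congr T.entry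
    rw [Nat.card_fin] at h
    rw [← h]
    exact (Nat.card_eq_fintype_card.trans (Fintype.card_coe μ.cells)).symm
  exact ⟨⟨⟨μ, h⟩, T, T'⟩, rfl⟩

theorem walks_finite (d L : ℕ) (p : Fin d → ℤ) : (walks d L p).Finite := by
  refine (Set.Finite.pi' fun k : Fin (L + 1) => Set.Finite.pi' fun _ : Fin d =>
    Set.finite_Icc (-(k : ℤ)) (k : ℤ)).subset ?_
  rintro w ⟨h0, -, hs⟩ k
  induction k using Fin.induction with
  | zero => intro j; simp [h0]
  | succ k ih =>
    intro j
    have h1 := ih j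
    have h2 := (Finset.single_le_sum (f := fun j => |w k.succ j - w k.castSucc j|)
      (fun _ _ => abs_nonneg _) (Finset.mem_univ j)).trans (hs k).le
    simp only [Set.mem_Icc, Fin.val_castSucc, Fin.val_succ] at h1 ⊢
    rw [abs_le] at h2
    push_cast
    constructor <;> linarith [h1.1, h1.2, h2.1, h2.2]

theorem blockWalks_finite (n r d : ℕ) (p : Fin d → ℤ) : (blockWalks n r d p).Finite :=
  (walks_finite d _ p).subset fun _ hw => hw.1.1

end PlanarSubgraph

namespace PlanarSubgraph

open Finset

/-! All three numbers are compared with one count, `dominantPairs`: pairs of sequences of `n`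
subsets of `Fin d`, each of size `r`, with equal totals and with every prefix count weakly
decreasing in the letter.

Tableaux: reading off the column of each entry turns a tableau into a ballot word. For consecutive
entries, "weakly above" means "strictly to the right", so the block condition says that each block
of the word increases strictly, that is, lists an `r`-subset. For such words the ballot condition
need only be checked at block ends (`IsDominant.antitone_letterCount`). This gives
`tableauPairs_ncard`.

Walks: the two halves of a block walk are again two sequences of `r`-subsets, and the endpoint is
the difference of their totals. Adding the indicator of a set to a strictly decreasing integer
vector either keeps it strictly decreasing or makes two coordinates equal, so the reflection
principle applies one block at a time (`sum_eq_sum_chamber`). Using it in both sequences turns the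
signed sum into the number of dominant pairs (`sum_sign_differencePairs`).

Multigraphs: the adjacency matrix is fed into the local rules of the RSK correspondence. The shapes
on the last row and the last column of the growth diagram form two chains of horizontal strips with
a common end. Regularity says that each strip has size `r`, and the first row of the final shape is
the largest size of a planar set of edges (`forall_isPlanar_card_le_iff`). The local rules are
invertible (`growth_injective`, `exists_growth`), and recording the columns that each strip meets
turns a chain into a dominant sequence (`IsStripChain.exists_conjugate`). This gives
`multigraphs_fin_ncard`. -/

/-! ### Sequences of `r`-subsets and their prefix counts -/

/-- The number of the first `k` sets of the sequence `S` that contain `j`. -/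
def prefixCount {n r d : ℕ} (S : Fin n → {s : Finset (Fin d) // s.card = r}) (k : ℕ) (j : Fin d) :
    ℕ :=
  ∑ i : Fin n, if (i : ℕ) < k ∧ j ∈ (S i).1 then 1 else 0

/-- All prefix counts of `S` are weakly decreasing. -/
def IsDominant {n r d : ℕ} (S : Fin n → {s : Finset (Fin d) // s.card = r}) : Prop :=
  ∀ k, Antitone (prefixCount S k)

theorem prefixCount_zero {n r d : ℕ} (S : Fin n → {s : Finset (Fin d) // s.card = r}) (j : Fin d) :
    prefixCount S 0 j = 0 := by
  simp [prefixCount]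

theorem prefixCount_cons {n r d : ℕ} (s : {s : Finset (Fin d) // s.card = r})
    (S : Fin n → {s : Finset (Fin d) // s.card = r}) (k : ℕ) (j : Fin d) :
    prefixCount (Fin.cons s S : Fin (n + 1) → {s : Finset (Fin d) // s.card = r}) (k + 1) j =
      (if j ∈ s.1 then 1 else 0) + prefixCount S k j := by
  rw [prefixCount, Fin.sum_univ_succ]
  simp [prefixCount]

theorem prefixCount_of_le {n r d : ℕ} (S : Fin n → {s : Finset (Fin d) // s.card = r}) {k : ℕ}
    (hk : n ≤ k) (j : Fin d) : prefixCount S k j = prefixCount S n j := by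
  refine Finset.sum_congr rfl fun i _ => ?_
  have h1 : (i : ℕ) < k := i.2.trans_le hk
  simp [h1]

theorem prefixCount_succ {n r d : ℕ} (S : Fin n → {s : Finset (Fin d) // s.card = r}) (k : Fin n)
    (j : Fin d) : prefixCount S (k + 1) j = prefixCount S k j + if j ∈ (S k).1 then 1 else 0 := by
  unfold prefixCount
  have h : ∀ i : Fin n, (if (i : ℕ) < k + 1 ∧ j ∈ (S i).1 then 1 else 0) =
      (if (i : ℕ) < k ∧ j ∈ (S i).1 then 1 else 0) +
        if i = k then (if j ∈ (S k).1 then 1 else 0) else 0 := by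
    intro i
    rcases lt_trichotomy i k with h | h | h
    · have h1 : (i : ℕ) < k := h
      simp [h1, h.ne, Nat.lt_succ_of_lt h1]
    · subst h; simp
    · have h1 : ¬ (i : ℕ) < k := not_lt.2 h.le
      have h2 : ¬ (i : ℕ) < k + 1 := by have : (k : ℕ) < i := h; omega
      simp [h1, h2, h.ne']
  rw [Finset.sum_congr rfl fun i _ => h i, Finset.sum_add_distrib]
  simp

/-! ### The reflection principle -/

/-- `φ` changes by the sign of the permutation when the coordinates are permuted. -/
def IsAntisymmetric {d : ℕ} (φ : (Fin d → ℤ) → ℤ) : Prop :=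
  ∀ (σ : Equiv.Perm (Fin d)) (y : Fin d → ℤ), φ (y ∘ σ) = Equiv.Perm.sign σ * φ y

theorem IsAntisymmetric.eq_zero {d : ℕ} {φ : (Fin d → ℤ) → ℤ} (hφ : IsAntisymmetric φ)
    {y : Fin d → ℤ} {i j : Fin d} (hij : i ≠ j) (h : y i = y j) : φ y = 0 := by
  have h1 : y ∘ Equiv.swap i j = y := by
    funext k
    simp only [Function.comp, Equiv.swap_apply_def]
    split_ifs with h2 h3
    · rw [h2, h]
    · rw [h3, h]
    · rfl
  have h2 := hφ (Equiv.swap i j) y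
  rw [h1, Equiv.Perm.sign_swap hij] at h2
  simp at h2
  omega

/-- The images of the members of a sequence of sets under a permutation. -/
def permSeq {n r d : ℕ} (σ : Equiv.Perm (Fin d)) :
    (Fin n → {s : Finset (Fin d) // s.card = r}) ≃ (Fin n → {s : Finset (Fin d) // s.card = r}) :=
  Equiv.piCongrRight fun _ => (Equiv.finsetCongr σ).subtypeEquiv fun s => by simp

theorem prefixCount_permSeq {n r d : ℕ} (σ : Equiv.Perm (Fin d))
    (S : Fin n → {s : Finset (Fin d) // s.card = r}) (k : ℕ) (j : Fin d) :
    prefixCount (permSeq σ S) k (σ j) = prefixCount S k j := by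
  simp [prefixCount, permSeq]

/-- The family of all sequences of `r`-subsets is invariant under permutations of `Fin d`, so a
permutation of the coordinates of `y` is absorbed by reindexing the sum. -/
theorem sum_antisymmetric {d : ℕ} (n r : ℕ) {φ : (Fin d → ℤ) → ℤ} (hφ : IsAntisymmetric φ) :
    IsAntisymmetric fun y => ∑ S : Fin n → {s : Finset (Fin d) // s.card = r},
      φ fun j => y j + prefixCount S n j := by
  intro σ y
  dsimp only
  rw [Finset.mul_sum]
  refine Fintype.sum_equiv (permSeq σ) _ _ fun S => ?_
  rw [← hφ σ]
  congr 1
  funext j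
  simp [prefixCount_permSeq]

/-- The reflection principle without an explicit involution: after a first set that leaves the
chamber, the sum over all continuations is an antisymmetric function evaluated at a point with two
equal coordinates. -/
theorem sum_eq_sum_chamber {d : ℕ} (n r : ℕ) {φ : (Fin d → ℤ) → ℤ} (hφ : IsAntisymmetric φ)
    {y : Fin d → ℤ} (hy : StrictAnti y) :
    ∑ S : Fin n → {s : Finset (Fin d) // s.card = r}, φ (fun j => y j + prefixCount S n j) =
      ∑ S : Fin n → {s : Finset (Fin d) // s.card = r},
        open Classical in
        if ∀ k, StrictAnti (fun j => y j + (prefixCount S k j : ℤ))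
          then φ (fun j => y j + prefixCount S n j) else 0 := by
  classical
  induction n generalizing y with
  | zero =>
    refine Finset.sum_congr rfl fun S _ => ?_
    have h : ∀ k j, prefixCount S k j = 0 := fun k j => by simp [prefixCount]
    rw [if_pos]
    intro k
    simpa [h] using hy
  | succ n ih =>
    rw [← (Fin.consEquiv fun _ : Fin (n + 1) => {s : Finset (Fin d) // s.card = r}).sum_comp,
      ← (Fin.consEquiv fun _ : Fin (n + 1) => {s : Finset (Fin d) // s.card = r}).sum_comp,
      Fintype.sum_prod_type, Fintype.sum_prod_type]
    refine Finset.sum_congr rfl fun s _ => ?_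
    simp only [Fin.consEquiv, Equiv.coe_fn_mk, prefixCount_cons]
    let z : Fin d → ℤ := fun j => y j + if j ∈ s.1 then 1 else 0
    have hz : ∀ (S : Fin n → {s : Finset (Fin d) // s.card = r}) k,
        (fun j => y j + (((if j ∈ s.1 then 1 else 0) + prefixCount S k j : ℕ) : ℤ)) =
          fun j => z j + prefixCount S k j := by
      intro S k; funext j; simp only [z]; push_cast; ring
    simp only [hz]
    by_cases hzc : StrictAnti z
    · rw [ih hzc]
      refine Finset.sum_congr rfl fun S _ => ?_
      congr 1
      refine propext ⟨fun h k => ?_, fun h k => ?_⟩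
      · cases k with
        | zero => simpa [prefixCount_zero] using hy
        | succ k => simp only [prefixCount_cons, hz]; exact h k
      · have := h (k + 1)
        simpa only [prefixCount_cons, hz] using this
    -- Every coordinate grows by at most one, so two integers in strict order can lose that order
    -- only by becoming equal.
    · have h0 : ∃ i j, i ≠ j ∧ z i = z j := by
        simp only [StrictAnti, not_forall] at hzc
        obtain ⟨i, j, hij, h⟩ := hzc
        refine ⟨i, j, hij.ne, ?_⟩
        have := hy hij
        simp only [z] at h ⊢
        split_ifs at h ⊢ <;> omega
      obtain ⟨i, j, hij, h⟩ := h0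
      rw [(sum_antisymmetric n r hφ).eq_zero hij h]
      refine (Finset.sum_eq_zero fun S _ => if_neg fun hS => hzc ?_).symm
      have := hS (0 + 1)
      simp only [prefixCount_cons, hz] at this
      simpa [prefixCount_zero] using this

/-- The alternating sum of the indicators of the points whose coordinates are those of `y`. -/
def alternant {d : ℕ} (y z : Fin d → ℤ) : ℤ :=
  ∑ π : Equiv.Perm (Fin d), Equiv.Perm.sign π * if z = y ∘ π then 1 else 0

theorem alternant_antisymmetric {d : ℕ} (y : Fin d → ℤ) : IsAntisymmetric (alternant y) := by
  intro σ z
  unfold alternant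
  rw [Finset.mul_sum]
  refine Fintype.sum_equiv (Equiv.mulRight σ⁻¹) _ _ fun π => ?_
  have h : z ∘ σ = y ∘ π ↔ z = y ∘ (π * σ⁻¹ : Equiv.Perm (Fin d)) := by
    constructor
    · intro h
      funext j
      have := congrFun h (σ⁻¹ j)
      simpa using this
    · rintro rfl
      funext j
      simp
  simp only [Equiv.coe_mulRight, h]
  rw [← mul_assoc]
  congr 1
  have : ((Equiv.Perm.sign σ : ℤˣ) : ℤ) * (Equiv.Perm.sign σ : ℤˣ) = 1 := by
    rw [← Units.val_mul, Int.units_mul_self]; rfl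
  simp [mul_comm (Equiv.Perm.sign π : ℤ), ← mul_assoc, this]

theorem alternant_symm {d : ℕ} (y z : Fin d → ℤ) : alternant y z = alternant z y := by
  unfold alternant
  refine Fintype.sum_equiv (Equiv.inv _) _ _ fun π => ?_
  have h : z = y ∘ π ↔ y = z ∘ (π⁻¹ : Equiv.Perm (Fin d)) := by
    constructor
    · rintro rfl
      funext j
      simp
    · rintro rfl
      funext j
      simp
  simp [h]

/-- An orbit under permutation of coordinates contains at most one strictly decreasing vector, and
that vector has trivial stabilizer; only the identity term can survive. -/
theorem alternant_of_strictAnti {d : ℕ} {y z : Fin d → ℤ} (hy : StrictAnti y) (hz : StrictAnti z) :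
    alternant y z = if z = y then 1 else 0 := by
  unfold alternant
  rw [Finset.sum_eq_single 1]
  · simp
  · intro π _ hπ
    rw [if_neg, mul_zero]
    rintro rfl
    have hm : StrictMono π := fun a b hab => by
      have := hz hab
      exact hy.lt_iff_gt.1 this
    apply hπ
    ext j
    -- The only order automorphism of `Fin d` is the identity.
    have := Subsingleton.elim (hm.orderIsoOfSurjective π π.surjective) (OrderIso.refl _)
    exact congrArg Fin.val (DFunLike.congr_fun this j)
  · simp

/-- The pairs of dominant sequences with the same total. -/
def dominantPairs (n r d : ℕ) : Set ((Fin n → {s : Finset (Fin d) // s.card = r}) ×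
    (Fin n → {s : Finset (Fin d) // s.card = r})) :=
  {x | IsDominant x.1 ∧ IsDominant x.2 ∧ prefixCount x.1 n = prefixCount x.2 n}

/-- The pairs of sequences whose totals differ by `p`. -/
def differencePairs (n r d : ℕ) (p : Fin d → ℤ) :
    Set ((Fin n → {s : Finset (Fin d) // s.card = r}) ×
      (Fin n → {s : Finset (Fin d) // s.card = r})) :=
  {x | ∀ j, (prefixCount x.1 n j : ℤ) - prefixCount x.2 n j = p j}

/-- The usual shift by a staircase; it identifies dominance with staying in the open chamber. -/
theorem strictAnti_neg_add_iff {d : ℕ} (c : Fin d → ℕ) :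
    StrictAnti (fun j : Fin d => -(j : ℤ) + c j) ↔ Antitone c := by
  constructor
  · intro h
    cases d with
    | zero => exact fun i => i.elim0
    | succ d =>
    refine Fin.antitone_iff_succ_le.2 fun i => ?_
    have := h (Fin.castSucc_lt_succ (i := i))
    simp at this
    omega
  · intro h i j hij
    have h1 := h hij.le
    have h2 : (i : ℕ) < j := hij
    dsimp only
    omega

/-- The double sum of the alternant of the two shifted totals is evaluated in two ways. Reflection
in each sequence separately leaves the dominant ones, for which the alternant is a Kronecker delta;
expanding the alternant over permutations gives the signed sum. -/
theorem sum_sign_differencePairs (n r d : ℕ) :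
    ∑ π : Equiv.Perm (Fin d), (Equiv.Perm.sign π : ℤ) *
      ((differencePairs n r d (toeplitzPoint π)).ncard : ℤ) = (dominantPairs n r d).ncard := by
  classical
  let δ : Fin d → ℤ := fun j => -(j : ℤ)
  have hδ : StrictAnti δ := fun i j hij => by
    have h2 : (i : ℕ) < j := hij
    simp only [δ]; omega
  have key : ∑ S : Fin n → {s : Finset (Fin d) // s.card = r},
      ∑ S' : Fin n → {s : Finset (Fin d) // s.card = r},
        alternant (fun j => δ j + prefixCount S n j) (fun j => δ j + prefixCount S' n j) =
      ((dominantPairs n r d).ncard : ℤ) := by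
    have h1 : ∀ S' : Fin n → {s : Finset (Fin d) // s.card = r},
        IsAntisymmetric fun y => alternant y (fun j => δ j + prefixCount S' n j) := by
      intro S'
      simp only [alternant_symm _ (fun j => δ j + (prefixCount S' n j : ℤ))]
      exact alternant_antisymmetric _
    rw [Finset.sum_comm, Finset.sum_congr rfl fun S' _ => sum_eq_sum_chamber n r (h1 S') hδ,
      Finset.sum_comm]
    have h2 : ∀ S : Fin n → {s : Finset (Fin d) // s.card = r},
        (∑ S' : Fin n → {s : Finset (Fin d) // s.card = r},
          if ∀ k, StrictAnti (fun j => δ j + (prefixCount S k j : ℤ)) then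
            alternant (fun j => δ j + prefixCount S n j) (fun j => δ j + prefixCount S' n j)
          else 0) = ∑ S' : Fin n → {s : Finset (Fin d) // s.card = r},
            if (S, S') ∈ dominantPairs n r d then 1 else 0 := by
      intro S
      simp only [δ, strictAnti_neg_add_iff]
      by_cases hS : IsDominant S
      · have hS' : ∀ k, Antitone (prefixCount S k) := hS
        simp only [hS', implies_true, if_true]
        have := sum_eq_sum_chamber n r
          (alternant_antisymmetric (fun j : Fin d => -(j : ℤ) + prefixCount S n j)) hδ
        simp only [δ] at this
        rw [this]
        refine Finset.sum_congr rfl fun S' _ => ?_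
        simp only [strictAnti_neg_add_iff]
        split_ifs with h3 h4 h4
        · rw [alternant_of_strictAnti ((strictAnti_neg_add_iff _).2 (hS n))
            ((strictAnti_neg_add_iff _).2 (h3 n)), if_pos]
          funext j
          rw [h4.2.2]
        · rw [alternant_of_strictAnti ((strictAnti_neg_add_iff _).2 (hS n))
            ((strictAnti_neg_add_iff _).2 (h3 n)), if_neg]
          intro h5
          refine h4 ⟨hS, h3, ?_⟩
          funext j
          have := congrFun h5 j
          simp at this
          exact this.symm
        · exact absurd h4.2.1 h3
        · rfl
      · have hS' : ¬ ∀ k, Antitone (prefixCount S k) := hS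
        simp only [hS', if_false]
        refine Finset.sum_congr rfl fun S' _ => ?_
        rw [if_neg]
        exact fun h => hS h.1
    rw [Finset.sum_congr rfl fun S _ => h2 S, ← Fintype.sum_prod_type'
      (f := fun S S' => if (S, S') ∈ dominantPairs n r d then (1 : ℤ) else 0)]
    rw [Set.ncard_eq_toFinset_card', Finset.sum_boole]
    congr 2
    ext x
    simp
  rw [← key]
  simp only [alternant]
  rw [Finset.sum_congr rfl fun S _ => Finset.sum_comm, Finset.sum_comm]
  refine Finset.sum_congr rfl fun π _ => ?_
  simp only [← Finset.mul_sum]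
  congr 1
  -- Replacing `S` by its image under `π` removes `π` from the prefix counts. The sums are exchanged
  -- so that `S'` becomes the first component, which makes the difference `j - π j` and not its
  -- negative.
  rw [Finset.sum_comm,
    Finset.sum_congr rfl fun S' _ => (Equiv.sum_comp (permSeq π) _).symm,
    ← Fintype.sum_prod_type' (f := fun S' S => if (fun j => δ j + (prefixCount S' n j : ℤ)) =
      (fun j => δ j + (prefixCount (permSeq π S) n j : ℤ)) ∘ π then (1 : ℤ) else 0)]
  rw [Set.ncard_eq_toFinset_card', Finset.sum_boole]
  congr 2
  ext x
  rw [Set.mem_toFinset]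
  simp only [differencePairs, toeplitzPoint, Set.mem_ofPred_eq, Finset.mem_filter,
    Finset.mem_univ, true_and, funext_iff, Function.comp, prefixCount_permSeq, δ]
  refine forall_congr' fun j => ?_
  constructor <;> intro h <;> linarith

/-! ### Words that are strictly increasing in blocks -/

/-- The number of occurrences of `j` among the first `t` letters of `a`. -/
def letterCount {m d : ℕ} (a : Fin m → Fin d) (t : ℕ) (j : Fin d) : ℕ :=
  #{x : Fin m | (x : ℕ) < t ∧ a x = j}

theorem letterCount_zero {m d : ℕ} (a : Fin m → Fin d) (j : Fin d) : letterCount a 0 j = 0 := by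
  simp [letterCount]

theorem letterCount_succ {m d : ℕ} (a : Fin m → Fin d) (k : Fin m) (j : Fin d) :
    letterCount a (k + 1) j = letterCount a k j + if a k = j then 1 else 0 := by
  unfold letterCount
  rw [card_filter, card_filter]
  have h : ∀ x : Fin m, (if (x : ℕ) < k + 1 ∧ a x = j then 1 else 0) =
      (if (x : ℕ) < k ∧ a x = j then 1 else 0) +
        if x = k then (if a k = j then 1 else 0) else 0 := by
    intro x
    rcases lt_trichotomy x k with h | h | h
    · have h1 : (x : ℕ) < k := h
      simp [h1, h.ne, Nat.lt_succ_of_lt h1]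
    · subst h; simp
    · have h1 : ¬ (x : ℕ) < k := not_lt.2 h.le
      have h2 : ¬ (x : ℕ) < k + 1 := by have : (k : ℕ) < x := h; omega
      simp [h1, h2, h.ne']
  rw [sum_congr rfl fun x _ => h x, sum_add_distrib]
  simp

theorem letterCount_of_le {m d : ℕ} (a : Fin m → Fin d) {t : ℕ} (ht : m ≤ t) (j : Fin d) :
    letterCount a t j = letterCount a m j := by
  unfold letterCount
  congr 1
  ext x
  have : (x : ℕ) < t := x.2.trans_le ht
  simp [this]

theorem strictInBlocks_iff {n r d : ℕ} (a : Fin (n * r) → Fin d) :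
    StrictInBlocks a ↔ ∀ i, StrictMono fun s => a (blockIndex i s) := by
  refine forall_congr' fun i => ⟨fun h => ?_, fun h s t hst => h (Fin.lt_def.2 (by omega))⟩
  cases r with
  | zero => exact fun s => s.elim0
  | succ r =>
    refine Fin.strictMono_iff_lt_succ.2 fun s => h _ _ ?_
    simp

/-- The word whose `i`-th block lists the `i`-th set of the sequence in increasing order. -/
def blockWord {n r d : ℕ} (S : Fin n → {s : Finset (Fin d) // s.card = r}) :
    Fin (n * r) → Fin d := fun x =>
  (S (finProdFinEquiv.symm x).1).1.orderEmbOfFin (S (finProdFinEquiv.symm x).1).2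
    (finProdFinEquiv.symm x).2

theorem blockWord_blockIndex {n r d : ℕ} (S : Fin n → {s : Finset (Fin d) // s.card = r})
    (i : Fin n) (s : Fin r) :
    blockWord S (blockIndex i s) = (S i).1.orderEmbOfFin (S i).2 s := by
  have h : ∀ p : Fin n × Fin r, p = (i, s) →
      (S p.1).1.orderEmbOfFin (S p.1).2 p.2 = (S i).1.orderEmbOfFin (S i).2 s := by
    rintro _ rfl; rfl
  exact h _ (finProdFinEquiv.symm_apply_apply _)

theorem blockWord_strict {n r d : ℕ} (S : Fin n → {s : Finset (Fin d) // s.card = r}) :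
    StrictInBlocks (blockWord S) := by
  rw [strictInBlocks_iff]
  intro i
  simp only [blockWord_blockIndex]
  exact ((S i).1.orderEmbOfFin (S i).2).strictMono

theorem blockWord_injective {n r d : ℕ} :
    Function.Injective (blockWord : (Fin n → {s : Finset (Fin d) // s.card = r}) → _) := by
  intro S S' h
  funext i
  have h1 : ∀ s, (S i).1.orderEmbOfFin (S i).2 s = (S' i).1.orderEmbOfFin (S' i).2 s := fun s => by
    rw [← blockWord_blockIndex, ← blockWord_blockIndex, h]
  ext j
  rw [← mem_coe, ← mem_coe, ← range_orderEmbOfFin _ (S i).2, ← range_orderEmbOfFin _ (S' i).2]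
  simp only [Set.mem_range, h1]

theorem exists_blockWord_eq {n r d : ℕ} {a : Fin (n * r) → Fin d} (ha : StrictInBlocks a) :
    ∃ S : Fin n → {s : Finset (Fin d) // s.card = r}, blockWord S = a := by
  rw [strictInBlocks_iff] at ha
  refine ⟨fun i => ⟨univ.image fun s => a (blockIndex i s), ?_⟩, ?_⟩
  · rw [card_image_of_injective _ (ha i).injective, card_univ, Fintype.card_fin]
  · funext x
    obtain ⟨⟨i, s⟩, rfl⟩ := finProdFinEquiv.surjective x
    change blockWord _ (blockIndex i s) = a (blockIndex i s)
    rw [blockWord_blockIndex]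
    refine (congrFun (orderEmbOfFin_unique (f := fun s => a (blockIndex i s)) _ ?_ (ha i)) s).symm
    simp

theorem blockIndex_val {n r : ℕ} (i : Fin n) (s : Fin r) :
    (blockIndex i s : ℕ) = s + r * i := by
  simp [blockIndex, finProdFinEquiv]

theorem blockIndex_lt_iff {n r : ℕ} (i : Fin n) (s : Fin r) (k : ℕ) :
    (blockIndex i s : ℕ) < r * k ↔ (i : ℕ) < k := by
  rw [blockIndex_val]
  constructor
  · intro h
    by_contra hk
    have := Nat.mul_le_mul_left r (not_lt.1 hk)
    omega
  · intro h
    have := Nat.mul_le_mul_left r (Nat.succ_le_of_lt h)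
    rw [Nat.mul_succ] at this
    omega

/-- The bridge between words read letter by letter and sequences read block by block. -/
theorem letterCount_blockWord {n r d : ℕ} (S : Fin n → {s : Finset (Fin d) // s.card = r}) (k : ℕ)
    (j : Fin d) : letterCount (blockWord S) (r * k) j = prefixCount S k j := by
  unfold letterCount prefixCount
  rw [card_filter, ← finProdFinEquiv.sum_comp, Fintype.sum_prod_type]
  refine sum_congr rfl fun i _ => ?_
  change ∑ s, (if (blockIndex i s : ℕ) < r * k ∧ blockWord S (blockIndex i s) = j then 1 else 0) = _
  simp only [blockIndex_lt_iff, blockWord_blockIndex]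
  by_cases hi : (i : ℕ) < k
  · simp only [hi, true_and]
    split_ifs with hj
    · rw [← mem_coe, ← range_orderEmbOfFin _ (S i).2] at hj
      obtain ⟨s, rfl⟩ := hj
      simp
    · refine sum_eq_zero fun s _ => if_neg ?_
      rintro rfl
      exact hj (orderEmbOfFin_mem _ _ _)
  · simp [hi]

theorem letterCount_blockWord_total {n r d : ℕ}
    (S : Fin n → {s : Finset (Fin d) // s.card = r}) (j : Fin d) :
    letterCount (blockWord S) (n * r) j = prefixCount S n j :=
  (congrArg (letterCount (blockWord S) · j) (mul_comm n r)).trans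
    (letterCount_blockWord S n j)

/-! ### Block walks -/

/-- The walk with the directions `a` of its positive steps, followed by negative steps with
directions `b`. -/
def walkOfWords {m d : ℕ} (a b : Fin m → Fin d) : Fin (m + m + 1) → Fin d → ℤ :=
  -- The truncated `t - m` keeps the second count at zero during the first half; in the second half
  -- the first count no longer changes.
  fun t j => letterCount a t j - letterCount b (t - m) j

theorem walkOfWords_isPosStep {m d : ℕ} (a b : Fin m → Fin d) (k : Fin m) :
    IsPosStep (walkOfWords a b) (Fin.castAdd m k) (a k) := by
  funext j
  have h1 : (k : ℕ) + 1 - m = 0 := by omega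
  have h2 : (k : ℕ) - m = 0 := by omega
  simp [walkOfWords, letterCount_succ, h1, h2, Pi.single_apply, eq_comm]

theorem walkOfWords_isNegStep {m d : ℕ} (a b : Fin m → Fin d) (k : Fin m) :
    IsNegStep (walkOfWords a b) (Fin.natAdd m k) (b k) := by
  funext j
  have h1 : m + (k : ℕ) + 1 - m = k + 1 := by omega
  have h2 : m + (k : ℕ) - m = k := by omega
  simp only [walkOfWords, Pi.sub_apply, Fin.val_succ, Fin.val_natAdd, Fin.val_castSucc, h1, h2,
    letterCount_succ, letterCount_of_le a (show m ≤ m + (k : ℕ) + 1 by omega),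
    letterCount_of_le a (show m ≤ m + (k : ℕ) by omega), Pi.neg_apply, Pi.single_apply,
    eq_comm (a := b k)]
  push_cast
  ring

theorem IsPosStep.unique {d L : ℕ} {w : Fin (L + 1) → Fin d → ℤ} {k : Fin L} {i j : Fin d}
    (hi : IsPosStep w k i) (hj : IsPosStep w k j) : i = j := by
  by_contra h
  have := congrFun (hi.symm.trans hj) i
  simp [h] at this

theorem IsNegStep.unique {d L : ℕ} {w : Fin (L + 1) → Fin d → ℤ} {k : Fin L} {i j : Fin d}
    (hi : IsNegStep w k i) (hj : IsNegStep w k j) : i = j := by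
  by_contra h
  have := congrFun (hi.symm.trans hj) i
  simp [h] at this

theorem IsPosStep.not_isNegStep {d L : ℕ} {w : Fin (L + 1) → Fin d → ℤ} {k : Fin L} {i j : Fin d}
    (hi : IsPosStep w k i) : ¬ IsNegStep w k j := by
  intro hj
  have := congrFun (hi.symm.trans hj) i
  simp only [Pi.single_eq_same, Pi.neg_apply, Pi.single_apply] at this
  split_ifs at this <;> omega

theorem eq_walkOfWords {m d : ℕ} {a b : Fin m → Fin d} {w : Fin (m + m + 1) → Fin d → ℤ}
    (h0 : w 0 = 0) (ha : ∀ k, IsPosStep w (Fin.castAdd m k) (a k))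
    (hb : ∀ k, IsNegStep w (Fin.natAdd m k) (b k)) : w = walkOfWords a b := by
  funext t
  induction t using Fin.induction with
  | zero => rw [h0]; funext j; simp [walkOfWords, letterCount_zero]
  | succ k ih =>
    have h1 : w k.succ - w k.castSucc =
        walkOfWords a b k.succ - walkOfWords a b k.castSucc := by
      refine Fin.addCases (fun k => ?_) (fun k => ?_) k
      · exact (ha k).trans (walkOfWords_isPosStep a b k).symm
      · exact (hb k).trans (walkOfWords_isNegStep a b k).symm
    rw [ih] at h1
    exact sub_left_injective h1

theorem walkOfWords_mem_walks {m d : ℕ} (a b : Fin m → Fin d) {p : Fin d → ℤ}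
    (hp : ∀ j, (letterCount a m j : ℤ) - letterCount b m j = p j) :
    walkOfWords a b ∈ walks d (m + m) p := by
  refine ⟨?_, ?_, fun k => ?_⟩
  · funext j; simp [walkOfWords, letterCount_zero]
  · funext j
    simp only [walkOfWords, Fin.val_last, Nat.add_sub_cancel]
    rw [letterCount_of_le a (by omega), hp]
  · have h : ∀ i j : Fin d, |(Pi.single i 1 : Fin d → ℤ) j| = if j = i then 1 else 0 := by
      intro i j
      rw [Pi.single_apply]
      split_ifs <;> simp
    refine Fin.addCases (fun k => ?_) (fun k => ?_) k
    · have h1 := walkOfWords_isPosStep a b k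
      refine (sum_congr rfl fun j _ => congrArg abs (congrFun h1 j)).trans ?_
      simp [h]
    · have h1 := walkOfWords_isNegStep a b k
      refine (sum_congr rfl fun j _ => congrArg abs (congrFun h1 j)).trans ?_
      simp [h]

theorem walkOfWords_mem_representatives {m d : ℕ} (a b : Fin m → Fin d)
    {W : Set (Fin (m + m + 1) → Fin d → ℤ)} (h : walkOfWords a b ∈ W) :
    walkOfWords a b ∈ representatives W := by
  refine ⟨h, fun k l i j hk hl => ?_⟩
  have h1 : (k : ℕ) < m := by
    by_contra hkm
    obtain ⟨k', rfl⟩ : ∃ k', k = Fin.natAdd m k' :=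
      ⟨⟨k - m, by omega⟩, Fin.ext (by simp; omega)⟩
    exact hk.not_isNegStep (walkOfWords_isNegStep a b k')
  have h2 : m ≤ (l : ℕ) := by
    by_contra hlm
    obtain ⟨l', rfl⟩ : ∃ l', l = Fin.castAdd m l' := ⟨⟨l, by omega⟩, rfl⟩
    exact (walkOfWords_isPosStep a b l').not_isNegStep hl
  exact Fin.lt_def.2 (h1.trans_le h2)

/-- A walk with prescribed step directions is unique, and words strictly increasing in blocks are
the same as sequences of `r`-subsets. -/
theorem blockWalks_ncard (n r d : ℕ) (p : Fin d → ℤ) :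
    (blockWalks n r d p).ncard = (differencePairs n r d p).ncard := by
  have h : blockWalks n r d p =
      (fun x => walkOfWords (blockWord x.1) (blockWord x.2)) '' differencePairs n r d p := by
    ext w
    constructor
    · rintro ⟨⟨hw, -⟩, a, b, ha, hb, hsa, hsb⟩
      obtain ⟨S, rfl⟩ := exists_blockWord_eq hsa
      obtain ⟨S', rfl⟩ := exists_blockWord_eq hsb
      have hw' := eq_walkOfWords hw.1 ha hb
      refine ⟨(S, S'), fun j => ?_, hw'.symm⟩
      have h1 := congrFun hw.2.1 j
      rw [hw'] at h1
      rw [← h1]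
      simp only [walkOfWords, Fin.val_last, Nat.add_sub_cancel]
      rw [letterCount_of_le (blockWord S) (by omega), letterCount_blockWord_total,
        letterCount_blockWord_total]
    · rintro ⟨⟨S, S'⟩, hS, rfl⟩
      refine ⟨walkOfWords_mem_representatives _ _ (walkOfWords_mem_walks _ _ fun j => ?_),
        blockWord S, blockWord S', walkOfWords_isPosStep _ _, walkOfWords_isNegStep _ _,
        blockWord_strict S, blockWord_strict S'⟩
      rw [letterCount_blockWord_total, letterCount_blockWord_total]
      exact hS j
  rw [h, Set.ncard_image_of_injective]
  rintro ⟨S, S'⟩ ⟨R, R'⟩ hSR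
  dsimp only at hSR
  refine Prod.ext (blockWord_injective (funext fun k => ?_))
    (blockWord_injective (funext fun k => ?_))
  · have h1 := walkOfWords_isPosStep (blockWord S) (blockWord S') k
    rw [hSR] at h1
    exact h1.unique (walkOfWords_isPosStep _ _ k)
  · have h1 := walkOfWords_isNegStep (blockWord S) (blockWord S') k
    rw [hSR] at h1
    exact h1.unique (walkOfWords_isNegStep _ _ k)

/-! ### Ballot words -/

theorem letterCount_mono {m d : ℕ} (a : Fin m → Fin d) (j : Fin d) :
    Monotone fun t => letterCount a t j := fun s t hst =>
  card_le_card fun x hx => by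
    simp only [mem_filter, mem_univ, true_and] at hx ⊢
    exact ⟨hx.1.trans_le hst, hx.2⟩

theorem exists_letter_of_letterCount_lt {m d : ℕ} {a : Fin m → Fin d} {j : Fin d} {s t : ℕ}
    (h : letterCount a s j < letterCount a t j) : ∃ x : Fin m, s ≤ x ∧ (x : ℕ) < t ∧ a x = j := by
  by_contra! hx
  refine h.not_ge (card_le_card fun x hx' => ?_)
  simp only [mem_filter, mem_univ, true_and] at hx' ⊢
  refine ⟨?_, hx'.2⟩
  by_contra hs
  exact hx x (not_lt.1 hs) hx'.1 hx'.2

theorem exists_letter_of_lt_letterCount {m d : ℕ} {a : Fin m → Fin d} {j : Fin d} {i t : ℕ}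
    (ht : t ≤ m) (h : i < letterCount a t j) :
    ∃ x : Fin m, a x = j ∧ letterCount a x j = i := by
  induction t with
  | zero => simp [letterCount_zero] at h
  | succ t ih =>
    have h1 := letterCount_succ a ⟨t, ht⟩ j
    simp only at h1
    rw [h1] at h
    by_cases h2 : i < letterCount a t j
    · exact ih (by omega) h2
    · split_ifs at h with h3
      · exact ⟨⟨t, ht⟩, h3, by simp only; omega⟩
      · omega

theorem letterCount_lt_of_lt {m d : ℕ} {a : Fin m → Fin d} {x : Fin m} {t : ℕ}
    (h : (x : ℕ) < t) : letterCount a x (a x) < letterCount a t (a x) := by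
  have h1 := letterCount_mono a (a x) (Nat.succ_le_of_lt h)
  have h2 := letterCount_succ a x (a x)
  simp only [if_true] at h2
  simp only [Nat.succ_eq_add_one] at h1
  omega

/-- Suppose that inside a block the count of `j'` exceeds that of a smaller `j`. Dominance at the
two ends of the block forces `j'` to occur in the block before time `t` and `j` to occur at time `t`
or later, although letters increase within a block. -/
theorem IsDominant.antitone_letterCount {n r d : ℕ}
    {S : Fin n → {s : Finset (Fin d) // s.card = r}} (hS : IsDominant S) (t : ℕ) :
    Antitone (letterCount (blockWord S) t) := by
  intro j j' hjj
  by_cases ht : n * r ≤ t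
  · rw [letterCount_of_le _ ht, letterCount_of_le _ ht, letterCount_blockWord_total,
      letterCount_blockWord_total]
    exact hS n hjj
  by_contra! hlt
  obtain ⟨⟨i, s⟩, his⟩ := finProdFinEquiv.surjective (⟨t, not_le.1 ht⟩ : Fin (n * r))
  have his' : (blockIndex i s : ℕ) = t := congrArg Fin.val his
  have h1 : ¬ t < r * i := by rw [← his', blockIndex_lt_iff]; omega
  have h2 : t < r * (i + 1) := by rw [← his', blockIndex_lt_iff]; omega
  have h3 : ∀ j, letterCount (blockWord S) t j ≤ prefixCount S (i + 1) j := fun j => by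
    rw [← letterCount_blockWord]; exact letterCount_mono _ j h2.le
  have h4 : ∀ j, prefixCount S i j ≤ letterCount (blockWord S) t j := fun j => by
    rw [← letterCount_blockWord]; exact letterCount_mono _ j (not_lt.1 h1)
  have h5 := hS i hjj
  have h6 := hS (i + 1) hjj
  have h7 : prefixCount S (i + 1) j' ≤ prefixCount S i j' + 1 := by
    rw [prefixCount_succ]; split_ifs <;> omega
  have h8 := h3 j'
  have h9 := h4 j
  have h10 := h3 j
  -- Dominance at the end of the block makes `j` catch up; dominance at its start means that `j'`
  -- got ahead only within the block, at `y`.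
  obtain ⟨x, hx1, hx2, hx3⟩ := exists_letter_of_letterCount_lt (a := blockWord S) (j := j)
    (s := t) (t := r * (i + 1)) (by rw [letterCount_blockWord]; omega)
  obtain ⟨y, hy1, hy2, hy3⟩ := exists_letter_of_letterCount_lt (a := blockWord S) (j := j')
    (s := r * i) (t := t) (by rw [letterCount_blockWord]; omega)
  have hblock : ∀ z : Fin (n * r), r * i ≤ z → (z : ℕ) < r * (i + 1) → ∃ s, z = blockIndex i s := by
    intro z hz1 hz2
    obtain ⟨⟨i', s'⟩, rfl⟩ := finProdFinEquiv.surjective z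
    have h1 := (blockIndex_lt_iff i' s' (i + 1)).1 hz2
    have h2 := mt (blockIndex_lt_iff i' s' i).2 (not_lt.2 hz1)
    obtain rfl : i' = i := Fin.ext (by omega)
    exact ⟨s', rfl⟩
  obtain ⟨sx, rfl⟩ := hblock x (by omega) hx2
  obtain ⟨sy, rfl⟩ := hblock y hy1 (by omega)
  have hlt' : sy < sx := by
    have : (blockIndex i sy : ℕ) < blockIndex i sx := by omega
    rw [blockIndex_val, blockIndex_val] at this
    exact Fin.lt_def.2 (by omega)
  have h11 := (strictInBlocks_iff _).1 (blockWord_strict S) i hlt'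
  simp only [hx3, hy3] at h11
  exact h11.not_ge hjj

/-! ### Column words of standard tableaux -/

namespace StandardTableau

variable {μ : YoungDiagram} {m : ℕ}

/-- The index of the column that contains the entry `x`. -/
def col (T : StandardTableau μ m) (x : Fin m) : ℕ := (T.entry.symm x).1.2

theorem row_col_mem (T : StandardTableau μ m) (x : Fin m) : (T.row x, T.col x) ∈ μ :=
  (T.entry.symm x).2

theorem entry_row_col (T : StandardTableau μ m) (x : Fin m) :
    T.entry ⟨(T.row x, T.col x), T.row_col_mem x⟩ = x :=
  T.entry.apply_symm_apply x

theorem row_entry (T : StandardTableau μ m) (c : {c : ℕ × ℕ // c ∈ μ}) :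
    T.row (T.entry c) = c.1.1 := by
  simp [row]

theorem col_entry (T : StandardTableau μ m) (c : {c : ℕ × ℕ // c ∈ μ}) :
    T.col (T.entry c) = c.1.2 := by
  simp [col]

/-- The comparison passes through the cell in the row of `x` and the column of `y`. -/
theorem le_of_row_col_le (T : StandardTableau μ m) {x y : Fin m} (hr : T.row x ≤ T.row y)
    (hc : T.col x ≤ T.col y) : x ≤ y := by
  have hmem : (T.row x, T.col y) ∈ μ := μ.up_left_mem hr le_rfl (T.row_col_mem y)
  have h1 : x ≤ T.entry ⟨_, hmem⟩ := by
    rcases hc.eq_or_lt with h | h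
    · simp only [← h, T.entry_row_col]; exact le_rfl
    · have := T.row_lt ⟨_, T.row_col_mem x⟩ ⟨_, hmem⟩ rfl h
      rw [T.entry_row_col] at this
      exact this.le
  have h2 : T.entry ⟨_, hmem⟩ ≤ y := by
    rcases hr.eq_or_lt with h | h
    · simp only [h, T.entry_row_col]; exact le_rfl
    · have := T.col_lt ⟨_, hmem⟩ ⟨_, T.row_col_mem y⟩ rfl h
      rw [T.entry_row_col] at this
      exact this.le
  exact h1.trans h2

/-- If `y` were strictly right of and strictly below `x`, the cell in the row of `x` and the column
of `y` would hold an entry strictly between two consecutive numbers. -/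
theorem row_le_row_iff_of_succ (T : StandardTableau μ m) {x y : Fin m} (h : (y : ℕ) = x + 1) :
    T.row y ≤ T.row x ↔ T.col x < T.col y := by
  constructor
  · intro hr
    by_contra hc
    have := Fin.le_def.1 (T.le_of_row_col_le hr (not_lt.1 hc))
    omega
  · intro hc
    by_contra! hr
    have hmem : (T.row x, T.col y) ∈ μ := μ.up_left_mem hr.le le_rfl (T.row_col_mem y)
    have h1 := T.row_lt ⟨_, T.row_col_mem x⟩ ⟨_, hmem⟩ rfl hc
    have h2 := T.col_lt ⟨_, hmem⟩ ⟨_, T.row_col_mem y⟩ rfl hr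
    rw [T.entry_row_col] at h1 h2
    rw [Fin.lt_def] at h1 h2
    omega

theorem blockCondition_iff {n r : ℕ} (T : StandardTableau μ (n * r)) :
    T.BlockCondition ↔ ∀ (i : Fin n) (s t : Fin r), (t : ℕ) = s + 1 →
      T.col (blockIndex i s) < T.col (blockIndex i t) := by
  refine forall_congr' fun i => forall_congr' fun s => forall_congr' fun t =>
    imp_congr_right fun h => T.row_le_row_iff_of_succ ?_
  rw [blockIndex_val, blockIndex_val]
  omega

/-- Columns increase downwards, so the entries above `x` are exactly the smaller ones in its column.
Thus the column word determines the rows, and with them the shape. -/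
theorem row_eq_card (T : StandardTableau μ m) (x : Fin m) :
    T.row x = #{y : Fin m | y < x ∧ T.col y = T.col x} := by
  rw [← card_range (T.row x)]
  refine card_bij' (fun i hi => T.entry ⟨(i, T.col x),
    μ.up_left_mem (mem_range.1 hi).le le_rfl (T.row_col_mem x)⟩) (fun y _ => T.row y) ?_ ?_ ?_ ?_
  · intro i hi
    simp only [mem_filter, mem_univ, true_and, col_entry, and_true]
    have := T.col_lt ⟨(i, T.col x), μ.up_left_mem (mem_range.1 hi).le le_rfl (T.row_col_mem x)⟩
      ⟨_, T.row_col_mem x⟩ rfl (mem_range.1 hi)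
    rwa [T.entry_row_col] at this
  · intro y hy
    simp only [mem_filter, mem_univ, true_and] at hy
    rw [mem_range]
    by_contra hxy
    exact hy.1.not_ge (T.le_of_row_col_le (not_lt.1 hxy) hy.2.ge)
  · intro i hi
    exact T.row_entry _
  · intro y hy
    simp only [mem_filter, mem_univ, true_and] at hy
    simp only [← hy.2, T.entry_row_col]

theorem sigma_eq_of_col_eq {μ' : YoungDiagram} {T₁ T₂ : StandardTableau μ m}
    {T₁' T₂' : StandardTableau μ' m} (h₁ : T₁.col = T₁'.col) (h₂ : T₂.col = T₂'.col) :
    (⟨μ, T₁, T₂⟩ : Σ μ : YoungDiagram, StandardTableau μ m × StandardTableau μ m) =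
      ⟨μ', T₁', T₂'⟩ := by
  have hrow : ∀ {μ μ'} {T : StandardTableau μ m} {T' : StandardTableau μ' m}, T.col = T'.col →
      T.row = T'.row := fun {μ μ' T T'} h => by
    funext x
    rw [T.row_eq_card, T'.row_eq_card, h]
  have hle : ∀ {μ μ'} {T : StandardTableau μ m} {T' : StandardTableau μ' m}, T.col = T'.col →
      μ ≤ μ' := fun {μ μ' T T'} h => by
    intro c hc
    have h1 := T'.row_col_mem (T.entry ⟨c, hc⟩)
    rw [← h, ← hrow h, T.row_entry, T.col_entry] at h1
    exact h1
  obtain rfl : μ = μ' := le_antisymm (hle h₁) (hle h₁.symm)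
  have hT : ∀ {T T' : StandardTableau μ m}, T.col = T'.col → T = T' := fun {T T'} h => by
    refine ext_entry (Equiv.symm_bijective.injective (Equiv.ext fun x => Subtype.ext ?_))
    exact Prod.ext (congrFun (hrow h) x) (congrFun h x)
  rw [hT h₁, hT h₂]

theorem col_lt_rowLen (T : StandardTableau μ m) (x : Fin m) : T.col x < μ.rowLen 0 :=
  YoungDiagram.mem_iff_lt_rowLen.1 (μ.up_left_mem (Nat.zero_le _) le_rfl (T.row_col_mem x))

/-- Sliding an entry of column `j'` along its row to column `j` does not increase it, and the row
keeps distinct entries apart. -/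
theorem antitone_card_col (T : StandardTableau μ m) (t : ℕ) {j j' : ℕ} (h : j ≤ j') :
    #{x : Fin m | (x : ℕ) < t ∧ T.col x = j'} ≤ #{x : Fin m | (x : ℕ) < t ∧ T.col x = j} := by
  have hmem : ∀ x, T.col x = j' → (T.row x, j) ∈ μ := fun x hx =>
    μ.up_left_mem le_rfl (hx ▸ h) (T.row_col_mem x)
  refine card_le_card_of_forall_subsingleton
    (fun x y => T.row x = T.row y) (fun x hx => ?_) (fun y hy x hx x' hx' => ?_)
  · simp only [mem_filter, mem_univ, true_and] at hx
    refine ⟨T.entry ⟨_, hmem x hx.2⟩, ?_, (T.row_entry ⟨_, hmem x hx.2⟩).symm⟩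
    simp only [mem_filter, mem_univ, true_and, T.col_entry, and_true]
    refine (Fin.le_def.1 (T.le_of_row_col_le ?_ ?_)).trans_lt hx.1
    · rw [T.row_entry]
    · rw [T.col_entry]; exact h.trans hx.2.ge
  · simp only [mem_filter, mem_univ, true_and, Set.mem_ofPred_eq] at hx hx'
    have h1 : T.row x = T.row x' := hx.2.trans hx'.2.symm
    have h2 : T.col x = T.col x' := hx.1.2.trans hx'.1.2.symm
    exact le_antisymm (T.le_of_row_col_le h1.le h2.le) (T.le_of_row_col_le h1.ge h2.ge)

theorem card_col_eq (T T' : StandardTableau μ m) (j : ℕ) :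
    #{x : Fin m | T.col x = j} = #{x : Fin m | T'.col x = j} := by
  refine card_equiv (T.entry.symm.trans T'.entry) fun x => ?_
  simp only [mem_filter, mem_univ, true_and]
  simp [col]

/-- The diagram whose `j`-th column has length `C j`. -/
def ofColumns {d : ℕ} (C : Fin d → ℕ) (hC : Antitone C) : YoungDiagram where
  cells := univ.biUnion fun j : Fin d => (range (C j)).image fun i => (i, (j : ℕ))
  isLowerSet := by
    rintro ⟨i, j⟩ ⟨i', j'⟩ hle h
    obtain ⟨h1, h2⟩ := Prod.mk_le_mk.1 hle
    simp only [coe_biUnion, Set.mem_iUnion, coe_image, coe_range, Set.mem_image, Prod.mk.injEq,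
      Set.mem_Iio, mem_coe, mem_univ, exists_prop, true_and] at h ⊢
    obtain ⟨k, i, h3, rfl, rfl⟩ := h
    exact ⟨⟨j', h2.trans_lt k.2⟩, i', (h1.trans_lt h3).trans_le (hC h2), rfl, rfl⟩

theorem mem_ofColumns {d : ℕ} {C : Fin d → ℕ} {hC : Antitone C} {c : ℕ × ℕ} :
    c ∈ ofColumns C hC ↔ ∃ j : Fin d, c.1 < C j ∧ (j : ℕ) = c.2 := by
  rcases c with ⟨i, j⟩
  simp only [ofColumns, ← YoungDiagram.mem_cells, mem_biUnion, mem_univ, mem_image, mem_range,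
    Prod.mk.injEq, true_and]
  constructor
  · rintro ⟨k, i, h, rfl, rfl⟩
    exact ⟨k, h, rfl⟩
  · rintro ⟨k, h, rfl⟩
    exact ⟨k, i, h, rfl, rfl⟩

theorem rowLen_ofColumns_le {d : ℕ} (C : Fin d → ℕ) (hC : Antitone C) :
    (ofColumns C hC).rowLen 0 ≤ d := by
  by_contra! h
  obtain ⟨j, -, hj⟩ := mem_ofColumns.1 (YoungDiagram.mem_iff_lt_rowLen.2 h)
  exact j.2.ne hj

/-- The standard tableau with a given column word. -/
theorem exists_col_eq {d : ℕ} {C : Fin d → ℕ} (hC : Antitone C) {a : Fin m → Fin d}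
    (ha : ∀ t, Antitone (letterCount a t)) (haC : letterCount a m = C) :
    ∃ T : StandardTableau (ofColumns C hC) m, ∀ x, T.col x = a x := by
  subst haC
  -- Each entry goes to the bottom of its column, so its row is the number of earlier occurrences of
  -- the same letter.
  let f : Fin m → {c : ℕ × ℕ // c ∈ ofColumns (letterCount a m) hC} := fun x =>
    ⟨(letterCount a x (a x), a x), mem_ofColumns.2 ⟨a x, letterCount_lt_of_lt x.2, rfl⟩⟩
  have hf : Function.Bijective f := by
    constructor
    · intro x y hxy
      have h1 := congrArg Subtype.val hxy
      simp only [f, Prod.mk.injEq] at h1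
      obtain ⟨h1, h2⟩ := h1
      have h2' := Fin.ext h2
      rcases lt_trichotomy x y with h | h | h
      · have := letterCount_lt_of_lt (a := a) (Fin.lt_def.1 h)
        rw [h1, h2'] at this
        exact absurd this (lt_irrefl _)
      · exact h
      · have := letterCount_lt_of_lt (a := a) (Fin.lt_def.1 h)
        rw [← h1, h2'] at this
        exact absurd this (lt_irrefl _)
    · rintro ⟨⟨i, j'⟩, hc⟩
      obtain ⟨j, h1, h2⟩ := mem_ofColumns.1 hc
      obtain ⟨x, hx, hi⟩ := exists_letter_of_lt_letterCount le_rfl h1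
      refine ⟨x, Subtype.ext (Prod.ext ?_ ?_)⟩
      · simp only [f, hx, hi]
      · simp only [f, hx, h2]
  have key : ∀ x y, ((f x).1.1 = (f y).1.1 → (f x).1.2 < (f y).1.2 → x < y) ∧
      ((f x).1.2 = (f y).1.2 → (f x).1.1 < (f y).1.1 → x < y) := by
    intro x y
    constructor
    · intro h1 h2
      simp only [f] at h1 h2
      by_contra hxy
      have hne : x ≠ y := by rintro rfl; exact lt_irrefl _ h2
      have hlt : (y : ℕ) < x := Fin.lt_def.1 (lt_of_le_of_ne (not_lt.1 hxy) hne.symm)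
      have h3 := letterCount_mono a (a x) (Nat.succ_le_of_lt hlt)
      -- Were `y` placed first, then just afterwards column `a y` would be longer than column `a x`
      -- on its left, against the ballot condition at time `y + 1`.
      have h4 := ha (y + 1) (Fin.le_def.2 h2.le)
      have h5 := letterCount_succ a y (a y)
      simp only [if_true, Nat.succ_eq_add_one] at h3 h5
      omega
    · intro h1 h2
      simp only [f] at h1 h2
      by_contra hxy
      have h3 := letterCount_mono a (a x) (Fin.le_def.1 (not_lt.1 hxy))
      rw [Fin.ext h1] at h2 h3
      dsimp only at h3
      omega
  let e := Equiv.ofBijective f hf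
  refine ⟨⟨e.symm, fun c c' h1 h2 => ?_, fun c c' h1 h2 => ?_⟩, fun x => rfl⟩
  · obtain ⟨x, rfl⟩ := e.surjective c
    obtain ⟨y, rfl⟩ := e.surjective c'
    simp only [Equiv.symm_apply_apply]
    exact (key x y).1 h1 h2
  · obtain ⟨x, rfl⟩ := e.surjective c
    obtain ⟨y, rfl⟩ := e.surjective c'
    simp only [Equiv.symm_apply_apply]
    exact (key x y).2 h1 h2

theorem exists_blockWord_eq_col {n r d : ℕ} (T : StandardTableau μ (n * r)) (hd : μ.rowLen 0 ≤ d)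
    (hT : T.BlockCondition) : ∃ S : Fin n → {s : Finset (Fin d) // s.card = r},
      IsDominant S ∧ ∀ x, (blockWord S x : ℕ) = T.col x := by
  let a : Fin (n * r) → Fin d := fun x => ⟨T.col x, (T.col_lt_rowLen x).trans_le hd⟩
  have ha : StrictInBlocks a := fun i s t hst => Fin.lt_def.2 (T.blockCondition_iff.1 hT i s t hst)
  obtain ⟨S, hS⟩ := exists_blockWord_eq ha
  refine ⟨S, fun k j j' hjj => ?_, fun x => by rw [hS]⟩
  rw [← letterCount_blockWord, ← letterCount_blockWord, hS]
  have := T.antitone_card_col (r * k) (Fin.le_def.1 hjj)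
  simpa only [letterCount, a, Fin.ext_iff] using this

end StandardTableau

theorem tableauPairs_ncard (n r d : ℕ) :
    (tableauPairs n r d).ncard = (dominantPairs n r d).ncard := by
  let F : (Σ μ : YoungDiagram, StandardTableau μ (n * r) × StandardTableau μ (n * r)) →
      (Fin (n * r) → ℕ) × (Fin (n * r) → ℕ) := fun x => (x.2.1.col, x.2.2.col)
  let G : (Fin n → {s : Finset (Fin d) // s.card = r}) ×
      (Fin n → {s : Finset (Fin d) // s.card = r}) →
      (Fin (n * r) → ℕ) × (Fin (n * r) → ℕ) := fun x =>
    (fun k => blockWord x.1 k, fun k => blockWord x.2 k)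
  have hF : Function.Injective F := by
    rintro ⟨μ, T, T'⟩ ⟨ν, R, R'⟩ h
    exact StandardTableau.sigma_eq_of_col_eq (Prod.ext_iff.1 h).1 (Prod.ext_iff.1 h).2
  have hG : Function.Injective G := by
    rintro ⟨S, S'⟩ ⟨R, R'⟩ h
    exact Prod.ext
      (blockWord_injective (funext fun x => Fin.ext (congrFun (Prod.ext_iff.1 h).1 x)))
      (blockWord_injective (funext fun x => Fin.ext (congrFun (Prod.ext_iff.1 h).2 x)))
  -- Both sets are compared inside the pairs of column words, where the dependence on the shape has
  -- disappeared.
  rw [← Set.ncard_image_of_injective _ hF, ← Set.ncard_image_of_injective _ hG]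
  congr 1
  ext x
  constructor
  · rintro ⟨⟨μ, T, T'⟩, ⟨hd, hT, hT'⟩, rfl⟩
    dsimp only at hd hT hT'
    obtain ⟨S, hS, hST⟩ := T.exists_blockWord_eq_col hd hT
    obtain ⟨S', hS', hST'⟩ := T'.exists_blockWord_eq_col hd hT'
    refine ⟨(S, S'), ⟨hS, hS', funext fun j => ?_⟩, Prod.ext (funext hST) (funext hST')⟩
    dsimp only
    rw [← letterCount_blockWord_total, ← letterCount_blockWord_total]
    simp only [letterCount, Fin.is_lt, true_and, Fin.ext_iff, hST, hST']
    exact T.card_col_eq T' j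
  · rintro ⟨⟨S, S'⟩, ⟨hS, hS', hSS⟩, rfl⟩
    dsimp only at hS hS' hSS
    obtain ⟨T, hT⟩ := StandardTableau.exists_col_eq (hS n) hS.antitone_letterCount
      (funext fun j => letterCount_blockWord_total S j)
    -- The second tableau is built on the shape given by `S`; this is where equality of the totals
    -- enters.
    obtain ⟨T', hT'⟩ := StandardTableau.exists_col_eq (hS n) hS'.antitone_letterCount
      (funext fun j => (letterCount_blockWord_total S' j).trans (congrFun hSS j).symm)
    refine ⟨⟨_, T, T'⟩, ⟨StandardTableau.rowLen_ofColumns_le _ (hS n), ?_, ?_⟩,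
      Prod.ext (funext hT) (funext hT')⟩
    · rw [StandardTableau.blockCondition_iff]
      intro i s t hst
      rw [hT, hT]
      exact blockWord_strict S i s t hst
    · rw [StandardTableau.blockCondition_iff]
      intro i s t hst
      rw [hT', hT']
      exact blockWord_strict S' i s t hst

/-! ### Chains of horizontal strips -/

/-- The skew shape between `ν` and `μ` (given by their row lengths) is a horizontal strip. -/
def Interlaces (ν μ : ℕ → ℕ) : Prop := ∀ i, ν i ≤ μ i ∧ μ (i + 1) ≤ ν i

/-- `β 0, …, β n` is a chain of horizontal strips of size `r` that starts at the empty shape and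
ends at a shape with at most `d` columns. -/
structure IsStripChain (n r d : ℕ) (β : ℕ → ℕ → ℕ) : Prop where
  zero : β 0 = 0
  interlaces : ∀ k < n, Interlaces (β k) (β (k + 1))
  size : ∀ k ≤ n, ∑ i ∈ range (n + 1), β k i = r * k
  le : β n 0 ≤ d

namespace IsStripChain

variable {n r d : ℕ} {β : ℕ → ℕ → ℕ}

theorem antitone (h : IsStripChain n r d β) {k : ℕ} (hk : k ≤ n) : Antitone (β k) := by
  cases k with
  | zero => rw [h.zero]; exact antitone_const
  | succ k =>
    refine antitone_nat_of_succ_le fun i => ?_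
    have := h.interlaces k hk i
    omega

/-- A horizontal strip adds at most one new row. Hence sums over `range (n + 1)` see all rows. -/
theorem vanish (h : IsStripChain n r d β) {k : ℕ} (hk : k ≤ n) {i : ℕ} (hi : k ≤ i) :
    β k i = 0 := by
  induction k generalizing i with
  | zero => rw [h.zero]; rfl
  | succ k ih =>
    obtain ⟨i, rfl⟩ : ∃ i', i = i' + 1 := ⟨i - 1, by omega⟩
    have h1 := (h.interlaces k hk i).2
    rw [ih (by omega) (by omega)] at h1
    omega

theorem le_of_le (h : IsStripChain n r d β) {k : ℕ} (hk : k ≤ n) (i : ℕ) : β k i ≤ d := by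
  have key : ∀ m, k ≤ m → m ≤ n → β k 0 ≤ β m 0 := by
    intro m hm
    induction m, hm using Nat.le_induction with
    | base => exact fun _ => le_rfl
    | succ m _ ih => exact fun hm => (ih (by omega)).trans (h.interlaces m hm 0).1
  exact ((h.antitone hk (Nat.zero_le i)).trans (key n hk le_rfl)).trans h.le

end IsStripChain

/-- The conjugate of a composition with `d` parts. -/
def conjugate {d : ℕ} (c : Fin d → ℕ) (i : ℕ) : ℕ := #{j : Fin d | i < c j}

theorem val_lt_card_iff {d : ℕ} {A : Finset (Fin d)} (hA : ∀ j ∈ A, ∀ i ≤ j, i ∈ A) (j : Fin d) :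
    (j : ℕ) < #A ↔ j ∈ A := by
  constructor
  · intro h
    by_contra hj
    have h1 : A ⊆ Iio j := fun i hi => by
      rw [mem_Iio]
      by_contra hij
      exact hj (hA i hi j (not_lt.1 hij))
    have := card_le_card h1
    rw [Fin.card_Iio] at this
    omega
  · intro h
    have h1 : Iic j ⊆ A := fun i hi => hA j h i (mem_Iic.1 hi)
    have := card_le_card h1
    rw [Fin.card_Iic] at this
    omega

/-- Both sides say that the cell `(i, j)` lies in the diagram with column lengths `c`. -/
theorem lt_conjugate_iff {d : ℕ} {c : Fin d → ℕ} (hc : Antitone c) (i : ℕ) (j : Fin d) :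
    (j : ℕ) < conjugate c i ↔ i < c j := by
  unfold conjugate
  rw [val_lt_card_iff]
  · simp
  · intro j hj j' hjj
    simp only [mem_filter, mem_univ, true_and] at hj ⊢
    exact hj.trans_le (hc hjj)

theorem conjugate_injOn {d : ℕ} {c c' : Fin d → ℕ} (hc : Antitone c) (hc' : Antitone c')
    (h : conjugate c = conjugate c') : c = c' := by
  funext j
  refine eq_of_forall_lt_iff fun i => ?_
  rw [← lt_conjugate_iff hc, ← lt_conjugate_iff hc', h]

theorem prefixCount_le {n r d : ℕ} (S : Fin n → {s : Finset (Fin d) // s.card = r}) (k : ℕ)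
    (j : Fin d) : prefixCount S k j ≤ n := by
  unfold prefixCount
  refine (sum_le_card_nsmul _ _ 1 fun i _ => ?_).trans ?_
  · split_ifs <;> omega
  · simp

theorem sum_prefixCount {n r d : ℕ} (S : Fin n → {s : Finset (Fin d) // s.card = r}) {k : ℕ}
    (hk : k ≤ n) : ∑ j, prefixCount S k j = r * k := by
  induction k with
  | zero => simp [prefixCount_zero]
  | succ k ih =>
    have h := prefixCount_succ S ⟨k, hk⟩
    simp only at h
    rw [sum_congr rfl fun j _ => h j, sum_add_distrib, ih (by omega)]
    simp [(S ⟨k, hk⟩).2, mul_add]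

/-- A set raises each column length by at most one, which is the condition for a horizontal strip.
Conjugation ignores the order of the parts, so dominance plays no role here. -/
theorem isStripChain_conjugate {n r d : ℕ} (S : Fin n → {s : Finset (Fin d) // s.card = r}) :
    IsStripChain n r d fun k => conjugate (prefixCount S k) where
  zero := by funext i; simp [conjugate, prefixCount_zero]
  interlaces k hk i := by
    have h := prefixCount_succ S ⟨k, hk⟩
    simp only at h
    constructor
    · refine card_le_card fun j hj => ?_
      simp only [mem_filter, mem_univ, true_and] at hj ⊢
      rw [h]
      omega
    · refine card_le_card fun j hj => ?_
      simp only [mem_filter, mem_univ, true_and] at hj ⊢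
      rw [h] at hj
      split_ifs at hj <;> omega
  size k hk := by
    simp only [conjugate, card_filter]
    rw [sum_comm, ← sum_prefixCount S hk]
    refine sum_congr rfl fun j _ => ?_
    rw [← card_filter]
    have h := prefixCount_le S k j
    have : ({i ∈ range (n + 1) | i < prefixCount S k j}) = range (prefixCount S k j) := by
      ext i
      simp only [mem_filter, mem_range]
      omega
    rw [this, card_range]
  le := (card_le_univ _).trans (by simp)

theorem conjugate_chain_injective {n r d : ℕ}
    {S S' : Fin n → {s : Finset (Fin d) // s.card = r}} (hS : IsDominant S) (hS' : IsDominant S')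
    (h : ∀ k ≤ n, conjugate (prefixCount S k) = conjugate (prefixCount S' k)) : S = S' := by
  funext k
  ext j
  have h1 := congrFun (conjugate_injOn (hS k) (hS' k) (h k k.2.le)) j
  have h2 := congrFun (conjugate_injOn (hS (k + 1)) (hS' (k + 1)) (h (k + 1) k.2)) j
  rw [prefixCount_succ, prefixCount_succ] at h2
  split_ifs at h2 with h3 h4 h4
  · simp [h3, h4]
  · omega
  · omega
  · simp [h3, h4]

/-- The columns that meet the skew shape between `ν` and `μ`. -/
def stripColumns (N d : ℕ) (ν μ : ℕ → ℕ) : Finset (Fin d) :=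
  {j : Fin d | ∃ i ∈ range N, ν i ≤ j ∧ (j : ℕ) < μ i}

/-- Row `i` of the strip occupies the columns in `[ν i, μ i)`, and interlacing makes these intervals
disjoint. -/
theorem card_stripColumns {N d : ℕ} {ν μ : ℕ → ℕ} (h : Interlaces ν μ) (hν : Antitone ν)
    (hμ : ∀ i, μ i ≤ d) :
    #(stripColumns N d ν μ) = ∑ i ∈ range N, μ i - ∑ i ∈ range N, ν i := by
  have h1 : stripColumns N d ν μ = (range N).biUnion fun i =>
      (Ico (ν i) (μ i)).attachFin fun j hj => (mem_Ico.1 hj).2.trans_le (hμ i) := by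
    ext j
    simp [stripColumns]
  rw [h1, card_biUnion]
  · simp only [card_attachFin, Nat.card_Ico]
    exact sum_tsub_distrib _ fun i _ => (h i).1
  · have : ∀ i i', i < i' → Disjoint
        ((Ico (ν i) (μ i)).attachFin fun j hj => (mem_Ico.1 hj).2.trans_le (hμ i))
        ((Ico (ν i') (μ i')).attachFin fun j hj => (mem_Ico.1 hj).2.trans_le (hμ i')) := by
      intro i i' hii
      rw [disjoint_left]
      intro j hj hj'
      rw [mem_attachFin, mem_Ico] at hj hj'
      obtain ⟨e, rfl⟩ : ∃ e, i' = e + 1 := ⟨i' - 1, by omega⟩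
      have h2 := (h e).2
      have h3 := hν (show i ≤ e by omega)
      omega
    intro i _ i' _ hne
    rcases lt_or_gt_of_ne hne with hlt | hlt
    · exact this i i' hlt
    · exact (this i' i hlt).symm

theorem IsStripChain.exists_conjugate {n r d : ℕ} {β : ℕ → ℕ → ℕ} (h : IsStripChain n r d β) :
    ∃ S : Fin n → {s : Finset (Fin d) // s.card = r}, IsDominant S ∧
      ∀ k ≤ n, conjugate (prefixCount S k) = β k := by
  let S : Fin n → {s : Finset (Fin d) // s.card = r} := fun k =>
    ⟨stripColumns (n + 1) d (β k) (β (k + 1)), by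
      rw [card_stripColumns (h.interlaces k k.2) (h.antitone k.2.le) (h.le_of_le k.2),
        h.size _ k.2.le, h.size _ k.2, Nat.mul_succ, Nat.add_sub_cancel_left]⟩
  have hS : ∀ (k : Fin n) (j : Fin d), j ∈ (S k).1 ↔
      ∃ i ∈ range (n + 1), β k i ≤ j ∧ (j : ℕ) < β (k + 1) i := fun k j => by
    simp [S, stripColumns]
  -- Both sides express that the cell `(i, j)` lies in the `k`-th shape, described by columns and by
  -- rows; dominance and the conjugates are read off from this.
  have key : ∀ k ≤ n, ∀ i (j : Fin d), i < prefixCount S k j ↔ (j : ℕ) < β k i := by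
    intro k
    induction k with
    | zero => intro _ i j; simp [prefixCount_zero, h.zero]
    | succ k ih =>
      intro hk i j
      have ih := ih (by omega)
      have h1 := prefixCount_succ S ⟨k, hk⟩ j
      have h2 := hS ⟨k, hk⟩ j
      simp only at h1 h2
      rw [h1]
      constructor
      · intro hi
        by_cases h3 : i < prefixCount S k j
        · exact ((ih i j).1 h3).trans_le (h.interlaces k hk i).1
        · split_ifs at hi with h4
          · obtain ⟨i', -, h5, h6⟩ := h2.1 h4
            have h7 : ¬ i' < prefixCount S k j := fun h8 => by
              have := (ih i' j).1 h8
              omega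
            exact h6.trans_le (h.antitone hk (by omega))
          · omega
      · intro hj
        by_cases h3 : (j : ℕ) < β k i
        · have := (ih i j).2 h3
          omega
        · have h4 : i ∈ range (n + 1) := by
            rw [mem_range]
            by_contra hi
            rw [h.vanish hk (by omega)] at hj
            omega
          rw [if_pos (h2.2 ⟨i, h4, not_lt.1 h3, hj⟩)]
          cases i with
          | zero => omega
          | succ i =>
            have := (ih i j).2 (hj.trans_le (h.interlaces k hk i).2)
            omega
  refine ⟨S, fun k => ?_, fun k hk => ?_⟩
  · have : ∀ k ≤ n, Antitone (prefixCount S k) := fun k hk j j' hjj => by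
      by_contra! hlt
      have := (key k hk _ j').1 hlt
      exact lt_irrefl _ ((key k hk _ j).2 (lt_of_le_of_lt (Fin.le_def.1 hjj) this))
    rcases le_total k n with hk | hk
    · exact this k hk
    · have h1 : prefixCount S k = prefixCount S n := funext fun j => prefixCount_of_le S hk j
      rw [h1]
      exact this n le_rfl
  · funext i
    simp only [conjugate, key k hk i]
    have : ({j : Fin d | (j : ℕ) < β k i} : Finset (Fin d)) =
        (range (β k i)).attachFin fun j hj => (mem_range.1 hj).trans_le (h.le_of_le hk i) := by
      ext j; simp
    rw [this, card_attachFin, card_range]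

/-! ### Growth diagrams -/

/-- The local growth rule: the outer shape determined by the shapes `κ`, `μ`, `ν` at the other
corners of a cell and its content `m`. -/
def growUp (κ μ ν : ℕ → ℕ) (m : ℕ) : ℕ → ℕ
  | 0 => max (μ 0) (ν 0) + m
  | i + 1 => max (μ (i + 1)) (ν (i + 1)) + min (μ i) (ν i) - κ i

/-- The inverse local growth rule. -/
def growDown (ρ μ ν : ℕ → ℕ) (i : ℕ) : ℕ :=
  max (μ (i + 1)) (ν (i + 1)) + min (μ i) (ν i) - ρ (i + 1)

theorem Interlaces.growUp_left {κ μ ν : ℕ → ℕ} (hμ : Interlaces κ μ) (hν : Interlaces κ ν) (m : ℕ) :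
    Interlaces μ (growUp κ μ ν m) := by
  intro i
  have h1 := hμ i
  have h2 := hν i
  refine ⟨?_, by simp only [growUp]; omega⟩
  cases i with
  | zero => simp only [growUp]; omega
  | succ i =>
    have h3 := hμ i
    have h4 := hν i
    simp only [growUp]
    omega

theorem growUp_comm (κ μ ν : ℕ → ℕ) (m : ℕ) : growUp κ μ ν m = growUp κ ν μ m := by
  funext i
  cases i <;> simp only [growUp, max_comm, min_comm]

theorem growDown_comm (ρ μ ν : ℕ → ℕ) : growDown ρ μ ν = growDown ρ ν μ := by
  funext i
  simp only [growDown, max_comm, min_comm]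

theorem Interlaces.growUp_right {κ μ ν : ℕ → ℕ} (hμ : Interlaces κ μ) (hν : Interlaces κ ν)
    (m : ℕ) : Interlaces ν (growUp κ μ ν m) := by
  rw [growUp_comm]
  exact hν.growUp_left hμ m

theorem Interlaces.growDown_left {ρ μ ν : ℕ → ℕ} (hμ : Interlaces μ ρ) (hν : Interlaces ν ρ) :
    Interlaces (growDown ρ μ ν) μ := by
  intro i
  have h1 := hμ i
  have h2 := hν i
  have h3 := hμ (i + 1)
  have h4 := hν (i + 1)
  simp only [growDown]
  omega

theorem Interlaces.growDown_right {ρ μ ν : ℕ → ℕ} (hμ : Interlaces μ ρ) (hν : Interlaces ν ρ) :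
    Interlaces (growDown ρ μ ν) ν := by
  rw [growDown_comm]
  exact hν.growDown_left hμ

/-- Row `i` of `κ` and row `i + 1` of the outer shape have a sum that depends only on `μ` and `ν`,
so either determines the other. Interlacing makes the truncated subtractions exact. -/
theorem growDown_growUp {κ μ ν : ℕ → ℕ} (hμ : Interlaces κ μ) (hν : Interlaces κ ν) (m : ℕ) :
    growDown (growUp κ μ ν m) μ ν = κ := by
  funext i
  have h1 := hμ i
  have h2 := hν i
  simp only [growDown, growUp]
  omega

theorem growUp_growDown {ρ μ ν : ℕ → ℕ} (hμ : Interlaces μ ρ) (hν : Interlaces ν ρ) :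
    growUp (growDown ρ μ ν) μ ν (ρ 0 - max (μ 0) (ν 0)) = ρ := by
  funext i
  cases i with
  | zero =>
    have h1 := hμ 0
    have h2 := hν 0
    simp only [growUp]
    omega
  | succ i =>
    have h1 := hμ i
    have h2 := hν i
    have h3 := hμ (i + 1)
    have h4 := hν (i + 1)
    simp only [growUp, growDown]
    omega

/-- This is `max + min = sum`, row by row. The index shift leaves boundary terms in row `N`, which
vanish because `μ N` does. -/
theorem sum_growUp {κ μ ν : ℕ → ℕ} (hμ : Interlaces κ μ) (hν : Interlaces κ ν) (m : ℕ) {N : ℕ}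
    (hN : μ N = 0) :
    ∑ i ∈ range (N + 1), growUp κ μ ν m i + ∑ i ∈ range (N + 1), κ i =
      ∑ i ∈ range (N + 1), μ i + ∑ i ∈ range (N + 1), ν i + m := by
  have h0 : κ N = 0 := by have := (hμ N).1; omega
  have h1 : ∑ i ∈ range N, growUp κ μ ν m (i + 1) + ∑ i ∈ range N, κ i =
      ∑ i ∈ range N, max (μ (i + 1)) (ν (i + 1)) + ∑ i ∈ range N, min (μ i) (ν i) := by
    rw [← sum_add_distrib, ← sum_add_distrib]
    refine sum_congr rfl fun i _ => ?_
    have h1 := hμ i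
    have h2 := hν i
    simp only [growUp]
    omega
  have h2 : ∑ i ∈ range (N + 1), max (μ i) (ν i) + ∑ i ∈ range (N + 1), min (μ i) (ν i) =
      ∑ i ∈ range (N + 1), μ i + ∑ i ∈ range (N + 1), ν i := by
    rw [← sum_add_distrib, ← sum_add_distrib]
    exact sum_congr rfl fun i _ => max_add_min _ _
  rw [← h2, sum_range_succ' (growUp κ μ ν m), sum_range_succ κ, sum_range_succ (fun i => min _ _),
    sum_range_succ' (fun i => max _ _), h0, hN]
  simp only [growUp] at h1 ⊢
  omega

/-- The growth diagram of a matrix. -/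
def growth (M : ℕ → ℕ → ℕ) : ℕ → ℕ → ℕ → ℕ
  | 0, _ => 0
  | _ + 1, 0 => 0
  | i + 1, j + 1 => growUp (growth M i j) (growth M i (j + 1)) (growth M (i + 1) j) (M i j)

theorem growth_zero_left (M : ℕ → ℕ → ℕ) (j : ℕ) : growth M 0 j = 0 := by
  rw [growth]

theorem growth_zero_right (M : ℕ → ℕ → ℕ) (i : ℕ) : growth M i 0 = 0 := by
  cases i <;> rw [growth]

theorem growth_succ_succ (M : ℕ → ℕ → ℕ) (i j : ℕ) : growth M (i + 1) (j + 1) =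
    growUp (growth M i j) (growth M i (j + 1)) (growth M (i + 1) j) (M i j) := by
  rw [growth]

theorem interlaces_refl_zero : Interlaces 0 0 := fun _ => ⟨le_rfl, le_rfl⟩

theorem growth_interlaces (M : ℕ → ℕ → ℕ) (i j : ℕ) :
    Interlaces (growth M i j) (growth M i (j + 1)) ∧
      Interlaces (growth M i j) (growth M (i + 1) j) := by
  have step : ∀ i, (∀ j, Interlaces (growth M i j) (growth M i (j + 1))) →
      ∀ j, Interlaces (growth M i j) (growth M (i + 1) j) := by
    intro i hi j
    induction j with
    | zero => rw [growth_zero_right, growth_zero_right]; exact interlaces_refl_zero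
    | succ j ih => rw [growth_succ_succ]; exact (hi j).growUp_left ih _
  have hor : ∀ i j, Interlaces (growth M i j) (growth M i (j + 1)) := by
    intro i
    induction i with
    | zero => intro j; rw [growth_zero_left, growth_zero_left]; exact interlaces_refl_zero
    | succ i ih => intro j; rw [growth_succ_succ]; exact (ih j).growUp_right (step i ih j) _
  exact ⟨hor i j, step i (hor i) j⟩

theorem growth_vanish (M : ℕ → ℕ → ℕ) {i t : ℕ} (j : ℕ) (h : i ≤ t) : growth M i j t = 0 := by
  induction i generalizing t with
  | zero => rw [growth_zero_left]; rfl
  | succ i ih =>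
    obtain ⟨t, rfl⟩ : ∃ t', t = t' + 1 := ⟨t - 1, by omega⟩
    have h1 := ((growth_interlaces M i j).2 t).2
    rw [ih (by omega)] at h1
    omega

/-- By `sum_growUp` the sizes obey the inclusion-exclusion recursion of rectangle sums. -/
theorem growth_size (M : ℕ → ℕ → ℕ) {n i : ℕ} (j : ℕ) (hi : i ≤ n) :
    ∑ t ∈ range (n + 1), growth M i j t = ∑ k ∈ range i, ∑ l ∈ range j, M k l := by
  induction i generalizing j with
  | zero => simp [growth_zero_left]
  | succ i ih =>
    induction j with
    | zero => simp [growth_zero_right]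
    | succ j ihj =>
      have h := sum_growUp (growth_interlaces M i j).1 (growth_interlaces M i j).2 (M i j)
        (growth_vanish M (t := n) (j + 1) (by omega))
      rw [← growth_succ_succ, ih _ (by omega), ih _ (by omega), ihj] at h
      rw [sum_range_succ _ i] at h ⊢
      rw [sum_range_succ _ j] at ⊢
      omega

/-- The inverse rule recovers all shapes from the last row and column, with `a` and `b` the
distances from these; first rows then give the matrix entries. -/
theorem growth_injective {M M' : ℕ → ℕ → ℕ} {n : ℕ} (hrow : ∀ j ≤ n, growth M n j = growth M' n j)
    (hcol : ∀ i ≤ n, growth M i n = growth M' i n) :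
    ∀ i < n, ∀ j < n, M i j = M' i j := by
  have key : ∀ a ≤ n, ∀ b ≤ n, growth M (n - a) (n - b) = growth M' (n - a) (n - b) := by
    intro a
    induction a with
    | zero => intro _ b _; exact hrow _ (by omega)
    | succ a iha =>
      intro ha b
      induction b with
      | zero => intro _; exact hcol _ (by omega)
      | succ b ihb =>
        intro hb
        have h1 := iha (by omega) b (by omega)
        have h2 := iha (by omega) (b + 1) hb
        have h3 := ihb (by omega)
        obtain ⟨i, hi⟩ : ∃ i, n - (a + 1) = i := ⟨_, rfl⟩
        obtain ⟨j, hj⟩ : ∃ j, n - (b + 1) = j := ⟨_, rfl⟩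
        rw [show n - a = i + 1 by omega] at h1 h2
        rw [show n - b = j + 1 by omega] at h1 h3
        rw [hi] at h3
        rw [hj] at h2
        rw [hi, hj, ← growDown_growUp (growth_interlaces M i j).1 (growth_interlaces M i j).2 (M i j),
          ← growDown_growUp (growth_interlaces M' i j).1 (growth_interlaces M' i j).2 (M' i j),
          ← growth_succ_succ, ← growth_succ_succ, h1, h2, h3]
  have key' : ∀ i ≤ n, ∀ j ≤ n, growth M i j = growth M' i j := fun i hi j hj => by
    have := key (n - i) (by omega) (n - j) (by omega)
    rwa [Nat.sub_sub_self hi, Nat.sub_sub_self hj] at this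
  intro i hi j hj
  have h := congrFun (key' (i + 1) hi (j + 1) hj) 0
  rw [growth_succ_succ, growth_succ_succ] at h
  simp only [growUp, key' i hi.le (j + 1) hj, key' (i + 1) hi j hj.le] at h
  omega

/-- The growth diagram with prescribed last row and column, read backwards from the corner. -/
def decay (n : ℕ) (β κ : ℕ → ℕ → ℕ) : ℕ → ℕ → ℕ → ℕ
  | 0, b => β (n - b)
  | a + 1, 0 => κ (n - (a + 1))
  | a + 1, b + 1 => growDown (decay n β κ a b) (decay n β κ a (b + 1)) (decay n β κ (a + 1) b)

theorem decay_zero_right {n : ℕ} {β κ : ℕ → ℕ → ℕ} (h : β n = κ n) (a : ℕ) :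
    decay n β κ a 0 = κ (n - a) := by
  cases a with
  | zero => rw [decay]; exact h
  | succ a => rw [decay]

theorem decay_succ_succ (n : ℕ) (β κ : ℕ → ℕ → ℕ) (a b : ℕ) : decay n β κ (a + 1) (b + 1) =
    growDown (decay n β κ a b) (decay n β κ a (b + 1)) (decay n β κ (a + 1) b) := by
  rw [decay]

theorem decay_interlaces {n : ℕ} {β κ : ℕ → ℕ → ℕ} (h : β n = κ n)
    (hβ : ∀ k < n, Interlaces (β k) (β (k + 1))) (hκ : ∀ k < n, Interlaces (κ k) (κ (k + 1))) :
    (∀ a ≤ n, ∀ b < n, Interlaces (decay n β κ a (b + 1)) (decay n β κ a b)) ∧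
      ∀ a < n, ∀ b ≤ n, Interlaces (decay n β κ (a + 1) b) (decay n β κ a b) := by
  have step : ∀ a < n, (∀ b < n, Interlaces (decay n β κ a (b + 1)) (decay n β κ a b)) →
      ∀ b ≤ n, Interlaces (decay n β κ (a + 1) b) (decay n β κ a b) := by
    intro a ha hor b
    induction b with
    | zero =>
      intro _
      rw [decay_zero_right h, decay_zero_right h]
      have := hκ (n - (a + 1)) (by omega)
      rwa [show n - (a + 1) + 1 = n - a by omega] at this
    | succ b ih =>
      intro hb
      rw [decay_succ_succ]
      exact (hor b hb).growDown_left (ih (by omega))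
  have hor : ∀ a ≤ n, ∀ b < n, Interlaces (decay n β κ a (b + 1)) (decay n β κ a b) := by
    intro a
    induction a with
    | zero =>
      intro _ b hb
      rw [decay, decay]
      have := hβ (n - (b + 1)) (by omega)
      rwa [show n - (b + 1) + 1 = n - b by omega] at this
    | succ a ih =>
      intro ha b hb
      rw [decay_succ_succ]
      exact (ih (by omega) b hb).growDown_right (step a ha (ih (by omega)) b hb.le)
  exact ⟨hor, fun a ha => step a ha (hor a ha.le)⟩

theorem Interlaces.eq_zero {ν : ℕ → ℕ} (h : Interlaces ν 0) : ν = 0 := by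
  funext i
  have := (h i).1
  simpa using this

/-- Running the inverse rule from the prescribed border gives empty shapes on the opposite border,
since shapes only shrink and the chains start empty. The matrix is the content lost in first rows.
-/
theorem exists_growth {n : ℕ} {β κ : ℕ → ℕ → ℕ} (h : β n = κ n) (hβ0 : β 0 = 0) (hκ0 : κ 0 = 0)
    (hβ : ∀ k < n, Interlaces (β k) (β (k + 1))) (hκ : ∀ k < n, Interlaces (κ k) (κ (k + 1))) :
    ∃ M : ℕ → ℕ → ℕ, (∀ j ≤ n, growth M n j = β j) ∧ ∀ i ≤ n, growth M i n = κ i := by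
  obtain ⟨hor, ver⟩ := decay_interlaces h hβ hκ
  let Λ : ℕ → ℕ → ℕ → ℕ := fun i j => decay n β κ (n - i) (n - j)
  have h0r : ∀ i ≤ n, Λ i 0 = 0 := by
    have : ∀ a ≤ n, decay n β κ a n = 0 := by
      intro a
      induction a with
      | zero => intro _; rw [decay, Nat.sub_self, hβ0]
      | succ a ih =>
        intro ha
        have := ver a ha n le_rfl
        rw [ih (by omega)] at this
        exact this.eq_zero
    exact fun i hi => this _ (by omega)
  have h0l : ∀ j ≤ n, Λ 0 j = 0 := by
    have : ∀ b ≤ n, decay n β κ n b = 0 := by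
      intro b
      induction b with
      | zero => intro _; rw [decay_zero_right h, Nat.sub_self, hκ0]
      | succ b ih =>
        intro hb
        have := hor n le_rfl b hb
        rw [ih (by omega)] at this
        exact this.eq_zero
    exact fun j hj => this _ (by omega)
  have hstep : ∀ i < n, ∀ j < n, Λ (i + 1) (j + 1) =
      growUp (Λ i j) (Λ i (j + 1)) (Λ (i + 1) j)
        (Λ (i + 1) (j + 1) 0 - max (Λ i (j + 1) 0) (Λ (i + 1) j 0)) := by
    intro i hi j hj
    obtain ⟨a, ha⟩ : ∃ a, n - (i + 1) = a := ⟨_, rfl⟩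
    obtain ⟨b, hb⟩ : ∃ b, n - (j + 1) = b := ⟨_, rfl⟩
    simp only [Λ, ha, hb, show n - i = a + 1 by omega, show n - j = b + 1 by omega]
    -- Reading backwards exchanges the roles of the two middle corners.
    rw [decay_succ_succ, growUp_comm, max_comm]
    exact (growUp_growDown (hor a (by omega) b (by omega)) (ver a (by omega) b (by omega))).symm
  let M : ℕ → ℕ → ℕ := fun i j => Λ (i + 1) (j + 1) 0 - max (Λ i (j + 1) 0) (Λ (i + 1) j 0)
  have hM : ∀ i ≤ n, ∀ j ≤ n, growth M i j = Λ i j := by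
    intro i
    induction i with
    | zero => intro _ j hj; rw [growth_zero_left, h0l j hj]
    | succ i ih =>
      intro hi j
      induction j with
      | zero => intro _; rw [growth_zero_right, h0r _ hi]
      | succ j ihj =>
        intro hj
        rw [growth_succ_succ, ih (by omega) j (by omega), ih (by omega) (j + 1) hj,
          ihj (by omega), hstep i hi j hj]
  refine ⟨M, fun j hj => ?_, fun i hi => ?_⟩
  · rw [hM n le_rfl j hj]
    simp only [Λ, Nat.sub_self]
    rw [decay, Nat.sub_sub_self hj]
  · rw [hM i hi n le_rfl]
    simp only [Λ, Nat.sub_self]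
    rw [decay_zero_right h, Nat.sub_sub_self hi]

theorem growth_congr {M M' : ℕ → ℕ → ℕ} {n : ℕ} (h : ∀ i < n, ∀ j < n, M i j = M' i j) :
    ∀ i ≤ n, ∀ j ≤ n, growth M i j = growth M' i j := by
  intro i
  induction i with
  | zero => intro _ j _; rw [growth_zero_left, growth_zero_left]
  | succ i ih =>
    intro hi j
    induction j with
    | zero => intro _; rw [growth_zero_right, growth_zero_right]
    | succ j ihj =>
      intro hj
      rw [growth_succ_succ, growth_succ_succ, ih (by omega) j (by omega),
        ih (by omega) (j + 1) hj, ihj (by omega), h i hi j hj]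

/-! ### Planar subgraphs and growth diagrams -/

/-- The number of edges between the `i`-th and the `j`-th vertex of the color classes. -/
def adjacency {n : ℕ} (E : Multiset (Fin n × Fin n)) (i j : ℕ) : ℕ :=
  E.countP fun e => (e.1 : ℕ) = i ∧ (e.2 : ℕ) = j

theorem IsPlanar.mono {U V : Type*} [LinearOrder U] [LinearOrder V] {S T : Multiset (U × V)}
    (hT : IsPlanar T) (h : S ≤ T) : IsPlanar S := fun e he f hf =>
  hT e (Multiset.mem_of_le h he) f (Multiset.mem_of_le h hf)

/-- In the rectangle with last vertices `i` and `j`, an edge at `i` and an edge at `j`, neither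
joining `i` to `j`, cross. So apart from the copies of `(i, j)` a planar set avoids `i` or avoids
`j`, which is the recursion for the first row. -/
theorem IsPlanar.card_le_growth {n : ℕ} {E : Multiset (Fin n × Fin n)} (i j : ℕ) :
    ∀ S ≤ E, IsPlanar S → (∀ e ∈ S, (e.1 : ℕ) < i ∧ (e.2 : ℕ) < j) →
      Multiset.card S ≤ growth (adjacency E) i j 0 := by
  induction i generalizing j with
  | zero =>
    intro S _ _ hS
    rw [Multiset.eq_zero_of_forall_notMem fun e he => Nat.not_lt_zero _ (hS e he).1]
    exact Nat.zero_le _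
  | succ i ih =>
    induction j with
    | zero =>
      intro S _ _ hS
      rw [Multiset.eq_zero_of_forall_notMem fun e he => Nat.not_lt_zero _ (hS e he).2]
      exact Nat.zero_le _
    | succ j ihj =>
      intro S hSE hS hlt
      let p : Fin n × Fin n → Prop := fun e => (e.1 : ℕ) = i ∧ (e.2 : ℕ) = j
      have hA : Multiset.card (S.filter p) ≤ adjacency E i j := by
        rw [← Multiset.countP_eq_card_filter]
        exact Multiset.countP_le_of_le p hSE
      have hBS : S.filter (fun e => ¬ p e) ≤ S := Multiset.filter_le _ _
      have hB : Multiset.card (S.filter fun e => ¬ p e) ≤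
          max (growth (adjacency E) i (j + 1) 0) (growth (adjacency E) (i + 1) j 0) := by
        by_cases h1 : ∀ e ∈ S.filter (fun e => ¬ p e), (e.1 : ℕ) ≠ i
        · refine le_max_of_le_left (ih _ _ (hBS.trans hSE) (hS.mono hBS) fun e he => ?_)
          have := h1 e he
          have := hlt e (Multiset.mem_of_le hBS he)
          omega
        · refine le_max_of_le_right (ihj _ (hBS.trans hSE) (hS.mono hBS) fun f hf => ?_)
          have hfS := hlt f (Multiset.mem_of_le hBS hf)
          refine ⟨hfS.1, lt_of_le_of_ne (Nat.lt_succ_iff.1 hfS.2) fun hfj => ?_⟩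
          push Not at h1
          obtain ⟨e, he, hei⟩ := h1
          have heS := hlt e (Multiset.mem_of_le hBS he)
          have hpe := (Multiset.mem_filter.1 he).2
          have hpf := (Multiset.mem_filter.1 hf).2
          simp only [p] at hpe hpf
          refine hS e (Multiset.mem_of_le hBS he) f (Multiset.mem_of_le hBS hf)
            (Or.inr ⟨Fin.lt_def.2 ?_, Fin.lt_def.2 ?_⟩) <;> omega
      have := congrArg Multiset.card (Multiset.filter_add_not p S)
      rw [Multiset.card_add] at this
      rw [growth_succ_succ]
      simp only [growUp]
      omega

/-- An edge joining the last two vertices of the rectangle crosses no edge of the rectangle, so all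
its copies can be added to an optimal set for the larger of the two smaller rectangles. -/
theorem exists_isPlanar_card_eq {n : ℕ} (E : Multiset (Fin n × Fin n)) (i j : ℕ) :
    ∃ S ≤ E, IsPlanar S ∧ (∀ e ∈ S, (e.1 : ℕ) < i ∧ (e.2 : ℕ) < j) ∧
      Multiset.card S = growth (adjacency E) i j 0 := by
  induction i generalizing j with
  | zero => exact ⟨0, Multiset.zero_le _, by simp [IsPlanar], by simp, by simp [growth_zero_left]⟩
  | succ i ih =>
    induction j with
    | zero =>
      exact ⟨0, Multiset.zero_le _, by simp [IsPlanar], by simp, by simp [growth_zero_right]⟩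
    | succ j ihj =>
      have h0 : ∃ S ≤ E, IsPlanar S ∧ (∀ e ∈ S, (e.1 : ℕ) < i + 1 ∧ (e.2 : ℕ) < j + 1 ∧
          ¬ ((e.1 : ℕ) = i ∧ (e.2 : ℕ) = j)) ∧ Multiset.card S =
          max (growth (adjacency E) i (j + 1) 0) (growth (adjacency E) (i + 1) j 0) := by
        rcases le_total (growth (adjacency E) i (j + 1) 0) (growth (adjacency E) (i + 1) j 0)
          with h | h
        · obtain ⟨S, h1, h2, h3, h4⟩ := ihj
          refine ⟨S, h1, h2, fun e he => ?_, by rw [h4, max_eq_right h]⟩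
          have := h3 e he
          omega
        · obtain ⟨S, h1, h2, h3, h4⟩ := ih (j + 1)
          refine ⟨S, h1, h2, fun e he => ?_, by rw [h4, max_eq_left h]⟩
          have := h3 e he
          omega
      obtain ⟨S, h1, h2, h3, h4⟩ := h0
      let p : Fin n × Fin n → Prop := fun e => (e.1 : ℕ) = i ∧ (e.2 : ℕ) = j
      have hSp : ∀ e ∈ S + E.filter p, (e.1 : ℕ) ≤ i ∧ (e.2 : ℕ) ≤ j := by
        intro e he
        rcases Multiset.mem_add.1 he with he | he
        · have := h3 e he
          omega
        · have := (Multiset.mem_filter.1 he).2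
          exact ⟨this.1.le, this.2.le⟩
      refine ⟨S + E.filter p, ?_, ?_, fun e he => ?_, ?_⟩
      · have h5 : S ≤ E.filter fun e => ¬ p e :=
          Multiset.le_filter.2 ⟨h1, fun e he => (h3 e he).2.2⟩
        calc S + E.filter p ≤ E.filter (fun e => ¬ p e) + E.filter p := add_le_add h5 le_rfl
          _ = E := by rw [add_comm, Multiset.filter_add_not]
      · intro e he f hf
        have he' := hSp e he
        have hf' := hSp f hf
        rcases Multiset.mem_add.1 he with he | he
        · rcases Multiset.mem_add.1 hf with hf | hf
          · exact h2 e he f hf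
          · have := (Multiset.mem_filter.1 hf).2
            simp only [p] at this
            rw [Cross, Fin.lt_def, Fin.lt_def, Fin.lt_def, Fin.lt_def]
            omega
        · have := (Multiset.mem_filter.1 he).2
          simp only [p] at this
          rw [Cross, Fin.lt_def, Fin.lt_def, Fin.lt_def, Fin.lt_def]
          omega
      · have := hSp e he
        omega
      · rw [Multiset.card_add, h4, growth_succ_succ, ← Multiset.countP_eq_card_filter]
        rfl

theorem forall_isPlanar_card_le_iff {n : ℕ} (E : Multiset (Fin n × Fin n)) (d : ℕ) :
    (∀ S ≤ E, IsPlanar S → Multiset.card S ≤ d) ↔ growth (adjacency E) n n 0 ≤ d := by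
  constructor
  · intro h
    obtain ⟨S, h1, h2, -, h3⟩ := exists_isPlanar_card_eq E n n
    rw [← h3]
    exact h S h1 h2
  · intro h S h1 h2
    exact (h2.card_le_growth n n S h1 fun e _ => ⟨e.1.2, e.2.2⟩).trans h

theorem sum_adjacency_left {n : ℕ} (E : Multiset (Fin n × Fin n)) (i : Fin n) :
    ∑ j ∈ range n, adjacency E i j = (E.map Prod.fst).count i := by
  induction E using Multiset.induction with
  | empty => simp [adjacency]
  | cons e E ih =>
    rw [Multiset.map_cons, Multiset.count_cons, ← ih]
    simp only [adjacency, Multiset.countP_cons, sum_add_distrib]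
    congr 1
    by_cases h : i = e.1
    · subst h; simp
    · have h' : ¬ (e.1 : ℕ) = i := fun h1 => h (Fin.ext h1.symm)
      simp [h, h']

theorem sum_adjacency_right {n : ℕ} (E : Multiset (Fin n × Fin n)) (j : Fin n) :
    ∑ i ∈ range n, adjacency E i j = (E.map Prod.snd).count j := by
  induction E using Multiset.induction with
  | empty => simp [adjacency]
  | cons e E ih =>
    rw [Multiset.map_cons, Multiset.count_cons, ← ih]
    simp only [adjacency, Multiset.countP_cons, sum_add_distrib]
    congr 1
    by_cases h : j = e.2
    · subst h; simp
    · have h' : ¬ (e.2 : ℕ) = j := fun h1 => h (Fin.ext h1.symm)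
      simp [h, h']

theorem adjacency_eq_count {n : ℕ} (E : Multiset (Fin n × Fin n)) (i j : Fin n) :
    adjacency E i j = E.count (i, j) := by
  unfold adjacency Multiset.count
  refine Multiset.countP_congr rfl fun e _ => ?_
  rw [eq_comm (a := (i, j)), Prod.ext_iff, Fin.ext_iff, Fin.ext_iff]

theorem exists_adjacency_eq (n : ℕ) (M : ℕ → ℕ → ℕ) :
    ∃ E : Multiset (Fin n × Fin n), ∀ i < n, ∀ j < n, adjacency E i j = M i j := by
  refine ⟨∑ e : Fin n × Fin n, Multiset.replicate (M e.1 e.2) e, fun i hi j hj => ?_⟩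
  have := adjacency_eq_count (∑ e : Fin n × Fin n, Multiset.replicate (M e.1 e.2) e) ⟨i, hi⟩ ⟨j, hj⟩
  rw [this, Multiset.count_sum']
  simp [Multiset.count_replicate]

theorem isStripChain_growth_row {n r d : ℕ} {E : Multiset (Fin n × Fin n)}
    (h : E ∈ multigraphs (Fin n) (Fin n) r d) : IsStripChain n r d (growth (adjacency E) n) where
  zero := growth_zero_right _ _
  interlaces k _ := (growth_interlaces _ n k).1
  size k hk := by
    rw [growth_size _ _ le_rfl, sum_comm]
    rw [sum_congr rfl fun j hj => (sum_adjacency_right E ⟨j, (mem_range.1 hj).trans_le hk⟩).trans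
      (h.1.2 _)]
    simp [mul_comm]
  le := (forall_isPlanar_card_le_iff E d).1 h.2

theorem isStripChain_growth_col {n r d : ℕ} {E : Multiset (Fin n × Fin n)}
    (h : E ∈ multigraphs (Fin n) (Fin n) r d) :
    IsStripChain n r d fun k => growth (adjacency E) k n where
  zero := growth_zero_left _ _
  interlaces k _ := (growth_interlaces _ k n).2
  size k hk := by
    rw [growth_size _ _ hk]
    rw [sum_congr rfl fun i hi => (sum_adjacency_left E ⟨i, (mem_range.1 hi).trans_le hk⟩).trans
      (h.1.1 _)]
    simp [mul_comm]
  le := (forall_isPlanar_card_le_iff E d).1 h.2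

/-- Vertex degrees are the differences in size of consecutive border shapes. -/
theorem mem_multigraphs_of_isStripChain {n r d : ℕ} {E : Multiset (Fin n × Fin n)}
    {β κ : ℕ → ℕ → ℕ} (hβ : IsStripChain n r d β) (hκ : IsStripChain n r d κ)
    (hEβ : ∀ j ≤ n, growth (adjacency E) n j = β j)
    (hEκ : ∀ i ≤ n, growth (adjacency E) i n = κ i) : E ∈ multigraphs (Fin n) (Fin n) r d := by
  refine ⟨⟨fun i => ?_, fun j => ?_⟩, ?_⟩
  · have h1 := growth_size (adjacency E) (n := n) n i.2
    have h2 := growth_size (adjacency E) (n := n) n i.2.le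
    rw [hEκ _ i.2, hκ.size _ i.2, sum_range_succ] at h1
    rw [hEκ _ i.2.le, hκ.size _ i.2.le] at h2
    rw [← sum_adjacency_left]
    rw [Nat.mul_succ] at h1
    omega
  · have h1 := growth_size (adjacency E) (i := n) (j + 1) le_rfl
    have h2 := growth_size (adjacency E) (i := n) j le_rfl
    rw [hEβ _ j.2, hβ.size _ j.2, sum_comm, sum_range_succ] at h1
    rw [hEβ _ j.2.le, hβ.size _ j.2.le, sum_comm] at h2
    rw [← sum_adjacency_right]
    rw [Nat.mul_succ] at h1
    omega
  · rw [forall_isPlanar_card_le_iff, hEβ n le_rfl]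
    exact hβ.le

theorem multigraphs_fin_ncard (n r d : ℕ) :
    (multigraphs (Fin n) (Fin n) r d).ncard = (dominantPairs n r d).ncard := by
  let F : Multiset (Fin n × Fin n) → (Fin (n + 1) → ℕ → ℕ) × (Fin (n + 1) → ℕ → ℕ) := fun E =>
    (fun k => growth (adjacency E) n k, fun k => growth (adjacency E) k n)
  let G : (Fin n → {s : Finset (Fin d) // s.card = r}) ×
      (Fin n → {s : Finset (Fin d) // s.card = r}) →
      (Fin (n + 1) → ℕ → ℕ) × (Fin (n + 1) → ℕ → ℕ) := fun x =>
    (fun k => conjugate (prefixCount x.1 k), fun k => conjugate (prefixCount x.2 k))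
  have hF : Function.Injective F := by
    intro E E' h
    have h1 : ∀ k ≤ n, growth (adjacency E) n k = growth (adjacency E') n k := fun k hk =>
      congrFun (Prod.ext_iff.1 h).1 ⟨k, Nat.lt_succ_of_le hk⟩
    have h2 : ∀ k ≤ n, growth (adjacency E) k n = growth (adjacency E') k n := fun k hk =>
      congrFun (Prod.ext_iff.1 h).2 ⟨k, Nat.lt_succ_of_le hk⟩
    ext ⟨i, j⟩
    rw [← adjacency_eq_count, ← adjacency_eq_count]
    exact growth_injective h1 h2 i i.2 j j.2
  -- Injectivity is claimed only on dominant pairs, because conjugation forgets the order of the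
  -- columns.
  have hG : Set.InjOn G (dominantPairs n r d) := by
    rintro ⟨S, S'⟩ hS ⟨R, R'⟩ hR h
    exact Prod.ext
      (conjugate_chain_injective hS.1 hR.1 fun k hk =>
        congrFun (Prod.ext_iff.1 h).1 ⟨k, Nat.lt_succ_of_le hk⟩)
      (conjugate_chain_injective hS.2.1 hR.2.1 fun k hk =>
        congrFun (Prod.ext_iff.1 h).2 ⟨k, Nat.lt_succ_of_le hk⟩)
  rw [← Set.ncard_image_of_injective _ hF, ← hG.ncard_image]
  congr 1
  ext x
  constructor
  · rintro ⟨E, hE, rfl⟩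
    obtain ⟨S, hS, hSE⟩ := (isStripChain_growth_row hE).exists_conjugate
    obtain ⟨S', hS', hSE'⟩ := (isStripChain_growth_col hE).exists_conjugate
    -- The totals agree because both border chains end at the same corner shape.
    refine ⟨(S, S'), ⟨hS, hS', conjugate_injOn (hS n) (hS' n) ?_⟩, Prod.ext ?_ ?_⟩
    · rw [hSE n le_rfl, hSE' n le_rfl]
    · exact funext fun k => hSE k k.is_le
    · exact funext fun k => hSE' k k.is_le
  · rintro ⟨⟨S, S'⟩, ⟨hS, hS', hSS⟩, rfl⟩
    dsimp only at hS hS' hSS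
    have hβ := isStripChain_conjugate S
    have hκ := isStripChain_conjugate S'
    obtain ⟨M, hM1, hM2⟩ := exists_growth (n := n) (congrArg conjugate hSS) hβ.zero hκ.zero
      hβ.interlaces hκ.interlaces
    obtain ⟨E, hE⟩ := exists_adjacency_eq n M
    have hE' := growth_congr hE
    have h1 : ∀ j ≤ n, growth (adjacency E) n j = conjugate (prefixCount S j) := fun j hj => by
      rw [hE' n le_rfl j hj, hM1 j hj]
    have h2 : ∀ i ≤ n, growth (adjacency E) i n = conjugate (prefixCount S' i) := fun i hi => by
      rw [hE' i hi n le_rfl, hM2 i hi]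
    refine ⟨E, mem_multigraphs_of_isStripChain hβ hκ h1 h2, Prod.ext ?_ ?_⟩
    · exact funext fun k => h1 k k.is_le
    · exact funext fun k => h2 k k.is_le

/-! ### Change of color classes -/

theorem map_mem_multigraphs {U V U' V' : Type*} [LinearOrder U] [LinearOrder V] [LinearOrder U']
    [LinearOrder V'] (f : U ≃o U') (g : V ≃o V') {r d : ℕ} {E : Multiset (U × V)}
    (hE : E ∈ multigraphs U V r d) : E.map (Prod.map f g) ∈ multigraphs U' V' r d := by
  refine ⟨⟨fun u => ?_, fun v => ?_⟩, fun S hS hp => ?_⟩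
  · obtain ⟨u, rfl⟩ := f.surjective u
    rw [Multiset.map_map, ← hE.1.1 u, ← Multiset.count_map_eq_count' f _ f.injective,
      Multiset.map_map]
    rfl
  · obtain ⟨v, rfl⟩ := g.surjective v
    rw [Multiset.map_map, ← hE.1.2 v, ← Multiset.count_map_eq_count' g _ g.injective,
      Multiset.map_map]
    rfl
  · rw [← Multiset.card_map (Prod.map f.symm g.symm)]
    refine hE.2 _ ?_ ?_
    · refine (Multiset.map_le_map hS).trans_eq ?_
      rw [Multiset.map_map]
      refine (Multiset.map_congr rfl fun e _ => ?_).trans (Multiset.map_id _)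
      exact Prod.ext (f.symm_apply_apply _) (g.symm_apply_apply _)
    · intro e he e' he'
      obtain ⟨e, hm, rfl⟩ := Multiset.mem_map.1 he
      obtain ⟨e', hm', rfl⟩ := Multiset.mem_map.1 he'
      simpa [Cross] using hp e hm e' hm'

theorem multigraphs_ncard_le {U V U' V' : Type*} [LinearOrder U] [LinearOrder V] [LinearOrder U']
    [LinearOrder V'] [Fintype U'] [Fintype V'] (f : U ≃o U') (g : V ≃o V') (r d : ℕ) :
    (multigraphs U V r d).ncard ≤ (multigraphs U' V' r d).ncard :=
  Set.ncard_le_ncard_of_injOn _ (fun _ hE => map_mem_multigraphs f g hE)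
    (Multiset.map_injective (f.injective.prodMap g.injective)).injOn
    (multigraphs_finite U' V' r d)

theorem multigraphs_ncard_eq {U V : Type*} [Fintype U] [LinearOrder U] [Fintype V]
    [LinearOrder V] {n : ℕ} (hU : Fintype.card U = n) (hV : Fintype.card V = n) (r d : ℕ) :
    (multigraphs U V r d).ncard = (dominantPairs n r d).ncard := by
  rw [← multigraphs_fin_ncard]
  let f := Fintype.orderIsoFinOfCardEq U hU
  let g := Fintype.orderIsoFinOfCardEq V hV
  exact le_antisymm (multigraphs_ncard_le f.symm g.symm r d) (multigraphs_ncard_le f g r d)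

end PlanarSubgraph

/-! ### Comparison of the three counts -/

theorem mainTheorem3 (n r d : ℕ) {U V : Type*} [Fintype U] [LinearOrder U] [Fintype V]
    [LinearOrder V] (hU : Fintype.card U = n) (hV : Fintype.card V = n) :
    (PlanarSubgraph.multigraphs U V r d).ncard = (PlanarSubgraph.tableauPairs n r d).ncard ∧
    ((PlanarSubgraph.multigraphs U V r d).ncard : ℤ) =
      ∑ π : Equiv.Perm (Fin d), (Equiv.Perm.sign π : ℤ) *
        ((PlanarSubgraph.blockWalks n r d (PlanarSubgraph.toeplitzPoint π)).ncard : ℤ) := by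
  simp only [PlanarSubgraph.blockWalks_ncard]
  rw [PlanarSubgraph.multigraphs_ncard_eq hU hV, PlanarSubgraph.tableauPairs_ncard,
    PlanarSubgraph.sum_sign_differencePairs]
  exact ⟨rfl, rfl⟩
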